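/- **Setting.** For a security parameter $\kappa\in\mathbb N$ let public parameters be given: dimensions $d_1,d_2,d_3$, bit lengths $k\ge 1,\ \ell\ge 0$, LWE parameters $(n,q,\sigma)$ with $q\ge2$, $\sigma>0$, and an SIS parameter $t$, all functions of $\kappa$, such that $d_1,d_2,d_3,n,t$ and $\lceil\log_2 q\rceil$ are polynomially bounded in $\kappa$ and $t\ge 2n\log_2 q$. Let $\mathbb Z_q=\mathbb Z\cap[-q/2,q/2)$ with arithmetic modulo $q$, so $\mathbb Z_3=\{-1,0,1\}$, and let $\mathbb Q_{\langle k,\ell\rangle}=\{2^{-\ell}z : z\in\mathbb Z,\ -2^{k-1}\le z\le 2^{k-1}-1\}$. Let $\chi_\sigma$ denote the discrete Gaussian distribution on integer vectors or matrices, with probabilities proportional to $\exp(-\pi\|x\|^2/\sigma^2)$. "Polynomial-time adversary" means a (non-uniform) family of Boolean circuits of size polynomial in $\kappa$; "negligible" means smaller than every inverse polynomial in $\kappa$; two ensembles of distributions are *computationally indistinguishable* if every polynomial-time adversary accepts samples of the two with probabilities that differ by a negligible amount. **Protocol $\mathsf{Mult}$** (a client with inputs $X\in\mathbb Q_{\langle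 k,\ell\rangle}^{d_1\times d_2}$, $Y\in\mathbb Q_{\langle k,\ell\rangle}^{d_2\times d_3}$, and computing parties $P_0,P_1$). A sharing of a matrix $M$ is $[M]=([M]_0,[M]_1)=(U,\,M-U\bmod q)$ with $U$ uniform. * Setup: the client publishes uniform $A\in\mathbb Z_q^{n\times d_2}$, $B\in\mathbb Z_q^{n\times t}$. * Offline: the client samples $S\leftarrow\chi_\sigma^{n\times d_1}$, $E\leftarrow\chi_\sigma^{d_2\times d_1}$, $E'\leftarrow\chi_\sigma^{t\times d_1}$, computes $C=A^\top S+(2^\ell X)^\top+E\bmod q$ and $C'=B^\top S+E'\bmod q$, and sends $(C,C',[S]_i)$ to $P_i$. * Online: the client shares $\bar Y=2^\ell Y$ and sends $[\bar Y]_i$ to $P_i$; $P_i$ samples $[R]_i$ uniformly from $\mathbb Z_3^{t\times d_3}$, computes $[H]_i=A[\bar Y]_i+B[R]_i\bmod q$, and sends it to the other party; both form $H=[H]_0+[H]_1\bmod q$, and $P_i$ returns $[\bar Z]_i=C^\top[\bar Y]_i+C'^\top[R]_i-[S]_i^\top H\bmod q$ to the client, who outputs $Z=2^{-2\ell}([\bar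 Z]_0+[\bar Z]_1\bmod q)$. The *view* of $P_i$ consists of the messages it receives and its coins: $\mathrm{View}_i(X,Y)=(A,B,C,C',[S]_i,[\bar Y]_i,[R]_i,[H]_{1-i})$. **Assumptions.** *LWE*, with $m=d_2+t$ samples: $(A,A^\top s+e\bmod q)$ and $(A,w)$ are computationally indistinguishable, where $A\in\mathbb Z_q^{n\times m}$ and $w\in\mathbb Z_q^m$ are uniform, $s\leftarrow\chi_\sigma^n$ and $e\leftarrow\chi_\sigma^m$. *SIS*, with a norm bound $\beta=\beta(\kappa)\ge2$: every polynomial-time adversary that is given uniform $A\in\mathbb Z_q^{n\times t}$ and $h\in\mathbb Z_q^n$ finds a nonzero $r\in\mathbb Z^t$ with $\|r\|_{\max}\le\beta$ and $Ar\equiv h\pmod q$ with at most negligible probability. **Theorem.** Under the LWE and SIS assumptions, neither semi-honest, non-colluding computing party learns anything about the inputs $X,Y$ or the output $Z$ in the protocol $\mathsf{Mult}$. Precisely: for each $i\in\{0,1\}$ there is a simulator $\mathrm{Sim}_i$ (a family of polynomial-size circuits that are fed fair random coins), which gets neither $X$ nor $Y$ nor $Z$, such that for all families of inputs $X=X(\kappa)$,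 $Y=Y(\kappa)$ the view $\mathrm{View}_i(X,Y)$ is computationally indistinguishable from the output of $\mathrm{Sim}_i$. Moreover, $\mathrm{View}_i(X,Y)$ is computationally indistinguishable from a tuple of independent uniformly random matrices (over $\mathbb Z_3$ in the place of $[R]_i$ and over $\mathbb Z_q$ in all other places). -/

import Mathlib

open scoped Matrix

noncomputable section

namespace SecureMult

/-! ### Asymptotics in the security parameter -/

/-- A function of the security parameter is negligible if it decays faster than every inverse
polynomial. -/
def Negligible (f : ℕ → ℝ) : Prop :=
  Asymptotics.SuperpolynomialDecay Filter.atTop (fun κ : ℕ => (κ : ℝ)) f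

/-- `f` is bounded by a polynomial in the security parameter. -/
def PolyBounded (f : ℕ → ℕ) : Prop :=
  ∃ P : Polynomial ℕ, ∀ κ, f κ ≤ P.eval κ

/-! ### Boolean circuits

Polynomial-time adversaries are non-uniform: families of Boolean circuits of polynomial size. -/

/-- A wire of a circuit with inputs indexed by `ι`: an input, the output of the gate with the given
number, or a constant. -/
inductive Wire (ι : Type) : Type
  | input (i : ι)
  | gate (k : ℕ)
  | const (b : Bool)

/-- A Boolean circuit with inputs indexed by `ι` and outputs indexed by `o`: a list of NAND gates in
topological order, each given by its two argument wires, and a wire for each output. -/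
structure Circuit (ι o : Type) where
  gates : List (Wire ι × Wire ι)
  output : o → Wire ι

/-- The value of a wire on the input `x`, where `v` lists the values of the gates evaluated so far.
(A reference to a gate that has not been evaluated reads `false`.) -/
def Wire.value {ι : Type} (x : ι → Bool) (v : List Bool) : Wire ι → Bool
  | .input i => x i
  | .gate k => v.getD k false
  | .const b => b

/-- The values of all gates on the input `x`, in order. -/
def gateValues {ι : Type} (x : ι → Bool) (gates : List (Wire ι × Wire ι)) : List Bool :=
  gates.foldl (fun v g => v ++ [!(g.1.value x v && g.2.value x v)]) []

/-- The function computed by a circuit. -/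
def Circuit.eval {ι o : Type} (D : Circuit ι o) (x : ι → Bool) : o → Bool :=
  fun j => (D.output j).value x (gateValues x D.gates)

/-- The size of a circuit: the number of gates plus the number of outputs. -/
def Circuit.size {ι o : Type} [Fintype o] (D : Circuit ι o) : ℕ :=
  D.gates.length + Fintype.card o

/-- The probability that the circuit `D` outputs `1` on a bit string sampled from `P`. -/
def acceptProb {ι : Type} (D : Circuit ι Unit) (P : PMF (ι → Bool)) : ℝ :=
  (P.toOuterMeasure {x | D.eval x () = true}).toReal

/-- Computational indistinguishability of two ensembles of distributions on bit strings: every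
family of polynomial-size circuits has a negligible distinguishing advantage. -/
def CompIndist {ι : ℕ → Type} (P Q : ∀ κ, PMF (ι κ → Bool)) : Prop :=
  ∀ D : ∀ κ, Circuit (ι κ) Unit, PolyBounded (fun κ => (D κ).size) →
    Negligible fun κ => |acceptProb (D κ) (P κ) - acceptProb (D κ) (Q κ)|

/-- The output distribution of a circuit that is fed `c` independent fair coins. -/
def samplerDist {o : Type} {c : ℕ} (G : Circuit (Fin c) o) : PMF (o → Bool) :=
  (PMF.uniformOfFintype (Fin c → Bool)).map G.eval

/-! ### Binary encodings of vectors and matrices over `ℤ/q` -/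

/-- Bit positions of a matrix over `ZMod q`; an entry takes `⌈log₂ q⌉` bits. -/
abbrev MatBits (a b q : ℕ) : Type := Fin a × Fin b × Fin (Nat.clog 2 q)

/-- Bit positions of a vector over `ZMod q`. -/
abbrev VecBits (a q : ℕ) : Type := Fin a × Fin (Nat.clog 2 q)

/-- Binary encoding of a matrix, entry by entry. -/
def encMat {a b q : ℕ} (M : Matrix (Fin a) (Fin b) (ZMod q)) : MatBits a b q → Bool :=
  fun z => (M z.1 z.2.1).val.testBit z.2.2

/-- Binary encoding of a vector, entry by entry. -/
def encVec {a q : ℕ} (v : Fin a → ZMod q) : VecBits a q → Bool :=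
  fun z => (v z.1).val.testBit z.2

/-- The representative in `[-q/2, q/2)` of a residue class modulo `q`. -/
def centered {q : ℕ} (x : ZMod q) : ℤ := Int.bmod x.val q

/-! ### Discrete Gaussian distributions -/

/-- The Gaussian weight `exp (-π ‖x‖² / σ²)` (Euclidean norm). -/
def gaussWeight {ι : Type} [Fintype ι] (σ : ℝ) (x : ι → ℤ) : ℝ :=
  Real.exp (-Real.pi * (∑ i, (x i : ℝ) ^ 2) / σ ^ 2)

theorem summable_gauss_int {σ : ℝ} (hσ : 0 < σ) :
    Summable fun z : ℤ => Real.exp (-Real.pi * (z : ℝ) ^ 2 / σ ^ 2) := by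
  have hc : -(Real.pi / σ ^ 2) < 0 := by
    have : 0 < Real.pi / σ ^ 2 := by positivity
    linarith
  have h := Real.summable_exp_nat_mul_of_ge hc (f := fun i : ℕ => (i : ℝ) ^ 2) (fun i => by
    have : i ≤ i ^ 2 := Nat.le_self_pow (by norm_num) i
    exact_mod_cast this)
  refine Summable.of_nat_of_neg (h.congr fun i => ?_) (h.congr fun i => ?_) <;>
  · congr 1
    push_cast
    ring

theorem gaussWeight_eq_prod {ι : Type} [Fintype ι] (σ : ℝ) (x : ι → ℤ) :
    gaussWeight σ x = ∏ i, Real.exp (-Real.pi * (x i : ℝ) ^ 2 / σ ^ 2) := by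
  rw [gaussWeight, ← Real.exp_sum, Finset.mul_sum, Finset.sum_div]

theorem summable_gaussWeight {ι : Type} [Fintype ι] {σ : ℝ} (hσ : 0 < σ) :
    Summable fun x : ι → ℤ => gaussWeight σ x := by
  classical
  set g : ℤ → ℝ := fun z => Real.exp (-Real.pi * (z : ℝ) ^ 2 / σ ^ 2) with hg
  have hs : Summable g := summable_gauss_int hσ
  refine summable_of_sum_le (c := ∏ _i : ι, ∑' z, g z) (fun x => (Real.exp_pos _).le) fun u => ?_
  calc ∑ x ∈ u, gaussWeight σ x
      ≤ ∑ x ∈ Fintype.piFinset (fun i => u.image fun x => x i), gaussWeight σ x := by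
        refine Finset.sum_le_sum_of_subset_of_nonneg (fun x hx => ?_)
          fun x _ _ => (Real.exp_pos _).le
        exact Fintype.mem_piFinset.2 fun i => Finset.mem_image_of_mem _ hx
    _ = ∏ i, ∑ z ∈ u.image (fun x => x i), g z := by
        rw [Finset.prod_univ_sum]
        exact Finset.sum_congr rfl fun x _ => gaussWeight_eq_prod σ x
    _ ≤ ∏ _i : ι, ∑' z, g z :=
        Finset.prod_le_prod (fun i _ => Finset.sum_nonneg fun z _ => (Real.exp_pos _).le)
          fun i _ => hs.sum_le_tsum _ fun z _ => (Real.exp_pos _).le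

theorem tsum_gaussWeight_ne_zero {ι : Type} [Fintype ι] (σ : ℝ) :
    ∑' x : ι → ℤ, ENNReal.ofReal (gaussWeight σ x) ≠ 0 := by
  intro h
  have := ENNReal.tsum_eq_zero.1 h 0
  rw [ENNReal.ofReal_eq_zero] at this
  exact absurd this (not_le.2 (Real.exp_pos _))

theorem tsum_gaussWeight_ne_top {ι : Type} [Fintype ι] {σ : ℝ} (hσ : 0 < σ) :
    ∑' x : ι → ℤ, ENNReal.ofReal (gaussWeight σ x) ≠ ⊤ := by
  rw [← ENNReal.ofReal_tsum_of_nonneg (f := fun x : ι → ℤ => gaussWeight σ x)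
    (fun x => (Real.exp_pos _).le) (summable_gaussWeight hσ)]
  exact ENNReal.ofReal_ne_top

/-- The discrete Gaussian distribution of width `σ` over `ℤ^ι`:
`Pr[x] = exp (-π ‖x‖² / σ²) / ∑ y, exp (-π ‖y‖² / σ²)`. -/
def discreteGaussian (ι : Type) [Fintype ι] (σ : ℝ) (hσ : 0 < σ) : PMF (ι → ℤ) :=
  PMF.normalize (fun x => ENNReal.ofReal (gaussWeight σ x))
    (tsum_gaussWeight_ne_zero σ) (tsum_gaussWeight_ne_top hσ)

/-- An `a × b` integer matrix with discrete Gaussian distribution, reduced modulo `q`. -/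
def gaussMatrix (a b q : ℕ) (σ : ℝ) (hσ : 0 < σ) : PMF (Matrix (Fin a) (Fin b) (ZMod q)) :=
  (discreteGaussian (Fin a × Fin b) σ hσ).map fun x => Matrix.of fun i j => (x (i, j) : ZMod q)

/-- A uniformly random `a × b` matrix over `ZMod q`. -/
def uniformMatrix (a b q : ℕ) [NeZero q] : PMF (Matrix (Fin a) (Fin b) (ZMod q)) :=
  PMF.uniformOfFintype _

/-- A uniformly random vector over `ZMod q`. -/
def uniformVec (a q : ℕ) [NeZero q] : PMF (Fin a → ZMod q) :=
  PMF.uniformOfFintype _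

/-! ### The public parameters -/

/-- Public parameters of the protocol: matrix dimensions `d₁, d₂, d₃`, bit lengths `k, l` of the
fixed-point numbers, LWE parameters `n, q, σ` and SIS parameter `t`. -/
structure Params where
  d₁ : ℕ
  d₂ : ℕ
  d₃ : ℕ
  k : ℕ
  l : ℕ
  n : ℕ
  q : ℕ
  σ : ℝ
  t : ℕ
  k_pos : 0 < k
  two_le_q : 2 ≤ q
  σ_pos : 0 < σ

instance (p : Params) : NeZero p.q := ⟨by have := p.two_le_q; omega⟩

/-- All dimensions and the bit length of the modulus are polynomial in the security parameter. -/
structure PolyParams (p : ℕ → Params) : Prop where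
  d₁ : PolyBounded fun κ => (p κ).d₁
  d₂ : PolyBounded fun κ => (p κ).d₂
  d₃ : PolyBounded fun κ => (p κ).d₃
  n : PolyBounded fun κ => (p κ).n
  log_q : PolyBounded fun κ => Nat.clog 2 (p κ).q
  t : PolyBounded fun κ => (p κ).t

/-! ### Learning with errors -/

/-- Bit positions of an LWE instance with `m` samples. -/
abbrev LWEBits (n m q : ℕ) : Type := MatBits n m q ⊕ VecBits m q

/-- The LWE distribution `(A, Aᵀ s + e mod q)`, encoded. -/
def lweReal (n m q : ℕ) [NeZero q] (σ : ℝ) (hσ : 0 < σ) : PMF (LWEBits n m q → Bool) := do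
  let A ← uniformMatrix n m q
  let s ← discreteGaussian (Fin n) σ hσ
  let e ← discreteGaussian (Fin m) σ hσ
  let b : Fin m → ZMod q := Aᵀ *ᵥ (fun i => (s i : ZMod q)) + fun j => (e j : ZMod q)
  return Sum.elim (encMat A) (encVec b)

/-- The uniform distribution `(A, w)`, encoded. -/
def lweUniform (n m q : ℕ) [NeZero q] : PMF (LWEBits n m q → Bool) := do
  let A ← uniformMatrix n m q
  let w ← uniformVec m q
  return Sum.elim (encMat A) (encVec w)

/-- The decision-LWE assumption for the LWE parameters of `p` and `m` samples. -/
def LWEAssumption (p : ℕ → Params) (m : ℕ → ℕ) : Prop :=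
  CompIndist (fun κ => lweReal (p κ).n (m κ) (p κ).q (p κ).σ (p κ).σ_pos)
    (fun κ => lweUniform (p κ).n (m κ) (p κ).q)

/-! ### Short integer solution -/

/-- Bit positions of an SIS instance. -/
abbrev SISBits (n t q : ℕ) : Type := MatBits n t q ⊕ VecBits n q

/-- The integer encoded by a sign bit followed by the binary digits of the absolute value, least
significant digit first. -/
def decodeInt {w : ℕ} (b : Fin (w + 1) → Bool) : ℤ :=
  (if b 0 then -1 else 1) * ∑ j : Fin w, if b j.succ then 2 ^ (j : ℕ) else 0

/-- `r` is a nonzero integer vector of max-norm at most `β` with `A r = h mod q`. -/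
def IsSISSolution {n t q : ℕ} (β : ℝ) (A : Matrix (Fin n) (Fin t) (ZMod q)) (h : Fin n → ZMod q)
    (r : Fin t → ℤ) : Prop :=
  r ≠ 0 ∧ (∀ i, |(r i : ℝ)| ≤ β) ∧ h = A *ᵥ fun i => (r i : ZMod q)

/-- A uniformly random SIS instance `(A, h)`. -/
def sisInstance (n t q : ℕ) [NeZero q] :
    PMF (Matrix (Fin n) (Fin t) (ZMod q) × (Fin n → ZMod q)) := do
  let A ← uniformMatrix n t q
  let h ← uniformVec n q
  return (A, h)

/-- The probability that a circuit, on a random SIS instance, outputs a solution. The circuit writes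
each coordinate of its answer with a sign bit and `w` digits. -/
def sisSuccess {n t q w : ℕ} [NeZero q] (β : ℝ)
    (D : Circuit (SISBits n t q) (Fin t × Fin (w + 1))) : ℝ :=
  ((sisInstance n t q).toOuterMeasure {z | IsSISSolution β z.1 z.2
    fun i => decodeInt fun b => D.eval (Sum.elim (encMat z.1) (encVec z.2)) (i, b)}).toReal

/-- The (inhomogeneous) SIS assumption for the dimension `n`, the modulus `q` and the SIS parameter
`t` of `p` and for the max-norm bound `β`. -/
def SISAssumption (p : ℕ → Params) (β : ℕ → ℝ) : Prop :=
  ∀ (w : ℕ → ℕ)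
    (D : ∀ κ, Circuit (SISBits (p κ).n (p κ).t (p κ).q) (Fin (p κ).t × Fin (w κ + 1))),
    PolyBounded (fun κ => (D κ).size) → Negligible fun κ => sisSuccess (β κ) (D κ)

/-! ### The protocol -/

/-- The `k`-bit fixed-point numbers with `l` fractional bits: `2⁻ˡ z`, where
`-2^(k-1) ≤ z ≤ 2^(k-1) - 1`. -/
def fixedPoint (k l : ℕ) : Set ℝ :=
  {x | ∃ z : ℤ, -2 ^ (k - 1) ≤ z ∧ z ≤ 2 ^ (k - 1) - 1 ∧ x = z / 2 ^ l}

/-- The encoding `2ˡ X` of a fixed-point matrix (the floor returns the integer `2ˡ x`), regarded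
modulo `q`. -/
def encodeFixed {a b k : ℕ} (l q : ℕ) (X : Matrix (Fin a) (Fin b) (fixedPoint k l)) :
    Matrix (Fin a) (Fin b) (ZMod q) :=
  Matrix.of fun i j => ((⌊(2 : ℝ) ^ l * (X i j : ℝ)⌋ : ℤ) : ZMod q)

/-- Additive secret sharing: `(R, M - R mod q)` for a uniformly random `R`. -/
def share {a b q : ℕ} [NeZero q] (M : Matrix (Fin a) (Fin b) (ZMod q)) :
    PMF (Fin 2 → Matrix (Fin a) (Fin b) (ZMod q)) := do
  let R ← uniformMatrix a b q
  return ![R, M - R]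

/-- Reconstruction of a secret from its two shares. -/
def reconst {a b q : ℕ} (M : Fin 2 → Matrix (Fin a) (Fin b) (ZMod q)) :
    Matrix (Fin a) (Fin b) (ZMod q) :=
  M 0 + M 1

/-- A matrix with entries in `{-1, 0, 1}` (representatives of the residues modulo `3`), regarded
modulo `q`. -/
def ternary {a b : ℕ} (q : ℕ) (R : Matrix (Fin a) (Fin b) (ZMod 3)) :
    Matrix (Fin a) (Fin b) (ZMod q) :=
  R.map fun r => (centered r : ZMod q)

/-- Everything that is computed in an execution of the protocol and is sent to, sampled by or
computed by one of the parties, with the client's result `Z`. A function on `Fin 2` gives the share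
of each of the parties `P₀`, `P₁`. -/
structure Execution (p : Params) where
  A : Matrix (Fin p.n) (Fin p.d₂) (ZMod p.q)
  B : Matrix (Fin p.n) (Fin p.t) (ZMod p.q)
  C : Matrix (Fin p.d₂) (Fin p.d₁) (ZMod p.q)
  C' : Matrix (Fin p.t) (Fin p.d₁) (ZMod p.q)
  S : Fin 2 → Matrix (Fin p.n) (Fin p.d₁) (ZMod p.q)
  Y : Fin 2 → Matrix (Fin p.d₂) (Fin p.d₃) (ZMod p.q)
  R : Fin 2 → Matrix (Fin p.t) (Fin p.d₃) (ZMod 3)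
  H : Fin 2 → Matrix (Fin p.n) (Fin p.d₃) (ZMod p.q)
  Zbar : Fin 2 → Matrix (Fin p.d₁) (Fin p.d₃) (ZMod p.q)
  Z : Matrix (Fin p.d₁) (Fin p.d₃) ℝ

/-- `Mult.Setup`: the common reference string `(A, B)`. -/
def setup (p : Params) : PMF
    (Matrix (Fin p.n) (Fin p.d₂) (ZMod p.q) × Matrix (Fin p.n) (Fin p.t) (ZMod p.q)) := do
  let A ← uniformMatrix p.n p.d₂ p.q
  let B ← uniformMatrix p.n p.t p.q
  return (A, B)

/-- `Mult.Offline`: the LWE ciphertexts `C`, `C'` and the shares of `S`. -/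
def offline (p : Params) (A : Matrix (Fin p.n) (Fin p.d₂) (ZMod p.q))
    (B : Matrix (Fin p.n) (Fin p.t) (ZMod p.q))
    (X : Matrix (Fin p.d₁) (Fin p.d₂) (fixedPoint p.k p.l)) : PMF
    (Matrix (Fin p.d₂) (Fin p.d₁) (ZMod p.q) × Matrix (Fin p.t) (Fin p.d₁) (ZMod p.q) ×
      (Fin 2 → Matrix (Fin p.n) (Fin p.d₁) (ZMod p.q))) := do
  let Xbar := encodeFixed p.l p.q X
  let S ← gaussMatrix p.n p.d₁ p.q p.σ p.σ_pos
  let E ← gaussMatrix p.d₂ p.d₁ p.q p.σ p.σ_pos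
  let E' ← gaussMatrix p.t p.d₁ p.q p.σ p.σ_pos
  let S' ← share S
  return (Aᵀ * S + Xbarᵀ + E, Bᵀ * S + E', S')

/-- `Mult.Online`: the client shares `Y`, each party samples its share of `R`, the parties open the
shares of `H`, and each party returns its share of the product to the client. -/
def online (p : Params) (A : Matrix (Fin p.n) (Fin p.d₂) (ZMod p.q))
    (B : Matrix (Fin p.n) (Fin p.t) (ZMod p.q)) (C : Matrix (Fin p.d₂) (Fin p.d₁) (ZMod p.q))
    (C' : Matrix (Fin p.t) (Fin p.d₁) (ZMod p.q))
    (S : Fin 2 → Matrix (Fin p.n) (Fin p.d₁) (ZMod p.q))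
    (Y : Matrix (Fin p.d₂) (Fin p.d₃) (fixedPoint p.k p.l)) : PMF (Execution p) := do
  let Ysh ← share (encodeFixed p.l p.q Y)
  let R₀ ← uniformMatrix p.t p.d₃ 3
  let R₁ ← uniformMatrix p.t p.d₃ 3
  let R : Fin 2 → Matrix (Fin p.t) (Fin p.d₃) (ZMod 3) := ![R₀, R₁]
  let H : Fin 2 → Matrix (Fin p.n) (Fin p.d₃) (ZMod p.q) :=
    fun i => A * Ysh i + B * ternary p.q (R i)
  let Zbar : Fin 2 → Matrix (Fin p.d₁) (Fin p.d₃) (ZMod p.q) :=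
    fun i => Cᵀ * Ysh i + C'ᵀ * ternary p.q (R i) - (S i)ᵀ * reconst H
  return {
    A := A, B := B, C := C, C' := C', S := S, Y := Ysh, R := R, H := H, Zbar := Zbar
    Z := (reconst Zbar).map fun z => (centered z : ℝ) / 2 ^ (2 * p.l) }

/-- The protocol `Mult` on the client's inputs `X` and `Y`. -/
def mult (p : Params) (X : Matrix (Fin p.d₁) (Fin p.d₂) (fixedPoint p.k p.l))
    (Y : Matrix (Fin p.d₂) (Fin p.d₃) (fixedPoint p.k p.l)) : PMF (Execution p) := do
  let crs ← setup p
  let off ← offline p crs.1 crs.2 X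
  online p crs.1 crs.2 off.1 off.2.1 off.2.2 Y

/-! ### Views -/

/-- The view of a computing party: the messages `A, B`, `C, C'` and the shares of `S` and `Y`
received from the client, the random coins `R` of the party, and the share of `H` received from the
other party. (The parties have no private input; everything else they compute, including their
share of the product, is a function of the view.) -/
structure View (p : Params) where
  A : Matrix (Fin p.n) (Fin p.d₂) (ZMod p.q)
  B : Matrix (Fin p.n) (Fin p.t) (ZMod p.q)
  C : Matrix (Fin p.d₂) (Fin p.d₁) (ZMod p.q)
  C' : Matrix (Fin p.t) (Fin p.d₁) (ZMod p.q)
  S : Matrix (Fin p.n) (Fin p.d₁) (ZMod p.q)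
  Y : Matrix (Fin p.d₂) (Fin p.d₃) (ZMod p.q)
  R : Matrix (Fin p.t) (Fin p.d₃) (ZMod 3)
  H : Matrix (Fin p.n) (Fin p.d₃) (ZMod p.q)

/-- The view of party `Pᵢ` in an execution; the other party is `P_{1-i}`. -/
def Execution.view {p : Params} (i : Fin 2) (e : Execution p) : View p where
  A := e.A
  B := e.B
  C := e.C
  C' := e.C'
  S := e.S i
  Y := e.Y i
  R := e.R i
  H := e.H (1 - i)

/-- Bit positions of a view. -/
abbrev ViewBits (p : Params) : Type :=
  MatBits p.n p.d₂ p.q ⊕ MatBits p.n p.t p.q ⊕ MatBits p.d₂ p.d₁ p.q ⊕ MatBits p.t p.d₁ p.q ⊕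
    MatBits p.n p.d₁ p.q ⊕ MatBits p.d₂ p.d₃ p.q ⊕ MatBits p.t p.d₃ 3 ⊕ MatBits p.n p.d₃ p.q

/-- Binary encoding of a view. -/
def View.encode {p : Params} (v : View p) : ViewBits p → Bool :=
  Sum.elim (encMat v.A) <| Sum.elim (encMat v.B) <| Sum.elim (encMat v.C) <|
    Sum.elim (encMat v.C') <| Sum.elim (encMat v.S) <| Sum.elim (encMat v.Y) <|
      Sum.elim (encMat v.R) (encMat v.H)

/-- The distribution of the (encoded) view of party `Pᵢ` in the protocol on the inputs `X`, `Y`. -/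
def viewDist (i : Fin 2) (p : Params) (X : Matrix (Fin p.d₁) (Fin p.d₂) (fixedPoint p.k p.l))
    (Y : Matrix (Fin p.d₂) (Fin p.d₃) (fixedPoint p.k p.l)) : PMF (ViewBits p → Bool) :=
  (mult p X Y).map fun e => (e.view i).encode

/-- The distribution of an (encoded) view whose entries are all uniform and independent. -/
def uniformView (p : Params) : PMF (ViewBits p → Bool) := do
  let A ← uniformMatrix p.n p.d₂ p.q
  let B ← uniformMatrix p.n p.t p.q
  let C ← uniformMatrix p.d₂ p.d₁ p.q
  let C' ← uniformMatrix p.t p.d₁ p.q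
  let S ← uniformMatrix p.n p.d₁ p.q
  let Y ← uniformMatrix p.d₂ p.d₃ p.q
  let R ← uniformMatrix p.t p.d₃ 3
  let H ← uniformMatrix p.n p.d₃ p.q
  return View.encode { A := A, B := B, C := C, C' := C', S := S, Y := Y, R := R, H := H }

end SecureMult

end

noncomputable section

namespace SecureMult

/-! ### Asymptotics -/

/-! The view is moved to the uniform tuple in two steps, and the uniform tuple is then sampled with
coins.

The shares of `S` and `Y` held by one party are uniform and independent of the secrets. The share of
`H` received from the other party is a shift of `B R'`, where `R'` is ternary and unknown to the
receiver. By the leftover hash lemma, `(B, B R')` is close to `(B, W)` with `W` uniform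
(`leftover_hash`, `leftover_hash_matrix`). Since `q ^ (2 * n) ≤ 2 ^ t`, the error per column is at
most the fourth root of `q ^ (-n)`. SIS enters only here: the adversary that always answers with the
first basis vector succeeds with probability at least `q ^ (-n)`, so this quantity is negligible
when `n ≠ 0` (`inv_le_sisSuccess`). If `n = 0`, then `H` has no entries.

Once `H` is uniform, the columns of `C` and `C'` stacked on each other are `d₁` LWE samples with the
common matrix `(A | B)`, shifted by `Xᵀ`. A hybrid argument over the columns (`hybrid`) replaces
them by uniform columns, which absorb the shift. Adversaries are non-uniform, so `X`, the other
entries of the view and the seeds of all columns but one can be fixed at their best values and wired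
into the distinguisher. What remains to be computed is affine modulo `q` in the bits of the LWE
instance, hence has small circuits (`exists_lwe_distinguisher`).

The simulator outputs a nearly uniform view: each residue is a number of `⌈log₂ q⌉ + κ` random bits
reduced modulo `q` (modulo `3` for the ternary coins), at distance at most `2 ^ (-κ)` from uniform
(`exists_simulator`). -/

theorem PolyBounded.mono {f g : ℕ → ℕ} (hg : PolyBounded g) (h : ∀ κ, f κ ≤ g κ) :
    PolyBounded f :=
  let ⟨P, hP⟩ := hg
  ⟨P, fun κ => (h κ).trans (hP κ)⟩

theorem PolyBounded.add {f g : ℕ → ℕ} (hf : PolyBounded f) (hg : PolyBounded g) :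
    PolyBounded fun κ => f κ + g κ :=
  let ⟨P, hP⟩ := hf
  let ⟨Q, hQ⟩ := hg
  ⟨P + Q, fun κ => by rw [Polynomial.eval_add]; exact add_le_add (hP κ) (hQ κ)⟩

theorem PolyBounded.mul {f g : ℕ → ℕ} (hf : PolyBounded f) (hg : PolyBounded g) :
    PolyBounded fun κ => f κ * g κ :=
  let ⟨P, hP⟩ := hf
  let ⟨Q, hQ⟩ := hg
  ⟨P * Q, fun κ => by rw [Polynomial.eval_mul]; exact Nat.mul_le_mul (hP κ) (hQ κ)⟩

theorem PolyBounded.const (c : ℕ) : PolyBounded fun _ => c :=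
  ⟨Polynomial.C c, fun κ => by simp⟩

theorem PolyBounded.id : PolyBounded fun κ => κ :=
  ⟨Polynomial.X, fun κ => by simp⟩

theorem Negligible.mono {f g : ℕ → ℝ} (hg : Negligible g) (h : ∀ κ, |f κ| ≤ g κ) :
    Negligible f :=
  Asymptotics.SuperpolynomialDecay.trans_abs_le hg fun κ => (h κ).trans (le_abs_self _)

theorem Negligible.add {f g : ℕ → ℝ} (hf : Negligible f) (hg : Negligible g) :
    Negligible fun κ => f κ + g κ :=
  Asymptotics.SuperpolynomialDecay.add hf hg

theorem Negligible.polyBounded_mul {f : ℕ → ℝ} {d : ℕ → ℕ} (hf : Negligible f)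
    (hd : PolyBounded d) : Negligible fun κ => (d κ : ℝ) * f κ := by
  obtain ⟨P, hP⟩ := hd
  have h := Asymptotics.SuperpolynomialDecay.polynomial_mul hf (P.map (Nat.castRingHom ℝ))
  refine h.trans_abs_le fun κ => ?_
  have e : Polynomial.eval (κ : ℝ) (P.map (Nat.castRingHom ℝ)) = ((P.eval κ : ℕ) : ℝ) := by
    simp [Polynomial.eval_map, Polynomial.eval₂_at_natCast]
  simp only [abs_mul, e, Nat.abs_cast]
  gcongr
  exact hP κ

/-- Superpolynomial decay survives fourth roots: the fourth power of `κ ^ n * f κ` is at most `κ ^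
(4 * n) * g κ`, which still tends to zero. -/
theorem Negligible.of_pow_four_le {f g : ℕ → ℝ} (hg : Negligible g) (h : ∀ κ, f κ ^ 4 ≤ g κ) :
    Negligible f := by
  intro n
  have h4 : Filter.Tendsto (fun κ : ℕ => ((κ : ℝ) ^ n * f κ) ^ 4) Filter.atTop (nhds 0) := by
    refine squeeze_zero (fun κ => by positivity) (fun κ => ?_) (hg (n * 4))
    rw [mul_pow, ← pow_mul]
    gcongr
    exact h κ
  rw [tendsto_zero_iff_abs_tendsto_zero]
  have h' := (h4.sqrt).sqrt
  simp only [Real.sqrt_zero] at h'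
  refine h'.congr fun κ => ?_
  have : ((κ : ℝ) ^ n * f κ) ^ 4 = (((κ : ℝ) ^ n * f κ) ^ 2) ^ 2 := by ring
  rw [this, Real.sqrt_sq (by positivity), Real.sqrt_sq_eq_abs]
  rfl

theorem negligible_two_pow : Negligible fun κ => ((2 : ℝ) ^ κ)⁻¹ := by
  intro n
  have h := tendsto_pow_const_div_const_pow_of_one_lt n (one_lt_two : (1 : ℝ) < 2)
  simpa [div_eq_mul_inv] using h

/-! ### Events and distinguishing advantages -/

/-- The probability of the event `s`, as a real number. -/
def prob {β : Type} (s : Set β) (P : PMF β) : ℝ := (P.toOuterMeasure s).toReal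

theorem toOuterMeasure_le_one {β : Type} (s : Set β) (P : PMF β) : P.toOuterMeasure s ≤ 1 := by
  rw [PMF.toOuterMeasure_apply, ← P.tsum_coe]
  exact ENNReal.tsum_le_tsum fun x => Set.indicator_le_self _ _ _

theorem prob_nonneg {β : Type} (s : Set β) (P : PMF β) : 0 ≤ prob s P := ENNReal.toReal_nonneg

theorem prob_le_one {β : Type} (s : Set β) (P : PMF β) : prob s P ≤ 1 :=
  ENNReal.toReal_le_of_le_ofReal zero_le_one (by simpa using toOuterMeasure_le_one s P)

theorem prob_bind {α β : Type} [Fintype α] (s : Set β) (P : PMF α) (f : α → PMF β) :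
    prob s (P.bind f) = ∑ a, (P a).toReal * prob s (f a) := by
  rw [prob, PMF.toOuterMeasure_bind_apply, tsum_fintype, ENNReal.toReal_sum]
  · simp [prob]
  · intro a _
    exact ENNReal.mul_ne_top (P.apply_ne_top a)
      ((toOuterMeasure_le_one s (f a)).trans_lt ENNReal.one_lt_top).ne

theorem prob_map {α β : Type} (s : Set β) (P : PMF α) (f : α → β) :
    prob s (P.map f) = prob (f ⁻¹' s) P := by
  rw [prob, prob, PMF.toOuterMeasure_map_apply]

theorem sum_toReal {α : Type} [Fintype α] (P : PMF α) : ∑ a, (P a).toReal = 1 := by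
  rw [← ENNReal.toReal_sum fun a _ => P.apply_ne_top a, ← tsum_fintype (L := .unconditional _),
    P.tsum_coe, ENNReal.toReal_one]

/-- The difference of the probabilities of an event under two distributions. -/
def adv {β : Type} (s : Set β) (P Q : PMF β) : ℝ := |prob s P - prob s Q|

theorem adv_self {β : Type} (s : Set β) (P : PMF β) : adv s P P = 0 := by simp [adv]

theorem adv_triangle {β : Type} (s : Set β) (P Q R : PMF β) :
    adv s P R ≤ adv s P Q + adv s Q R := abs_sub_le _ _ _

theorem adv_bind_le {α β : Type} [Fintype α] {s : Set β} (P : PMF α) {f g : α → PMF β} {ε : ℝ}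
    (h : ∀ a, adv s (f a) (g a) ≤ ε) : adv s (P.bind f) (P.bind g) ≤ ε := by
  rw [adv, prob_bind, prob_bind, ← Finset.sum_sub_distrib]
  calc |∑ a, ((P a).toReal * prob s (f a) - (P a).toReal * prob s (g a))|
      ≤ ∑ a, |(P a).toReal * prob s (f a) - (P a).toReal * prob s (g a)| :=
        Finset.abs_sum_le_sum_abs _ _
    _ ≤ ∑ a, (P a).toReal * ε := by
        refine Finset.sum_le_sum fun a _ => ?_
        rw [← mul_sub, abs_mul, abs_of_nonneg ENNReal.toReal_nonneg]
        exact mul_le_mul_of_nonneg_left (h a) ENNReal.toReal_nonneg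
    _ = ε := by rw [← Finset.sum_mul, sum_toReal, one_mul]

/-- An average is at most its maximum. This is how randomness shared by two experiments gets fixed
and later wired into a non-uniform adversary. -/
theorem exists_adv_bind_le {α β : Type} [Fintype α] (s : Set β) (P : PMF α) (f g : α → PMF β) :
    ∃ a, adv s (P.bind f) (P.bind g) ≤ adv s (f a) (g a) := by
  obtain ⟨a₀, -⟩ := P.support_nonempty
  obtain ⟨a, -, ha⟩ := Finset.exists_max_image Finset.univ (fun a => adv s (f a) (g a))
    ⟨a₀, Finset.mem_univ _⟩
  exact ⟨a, adv_bind_le P fun b => ha b (Finset.mem_univ _)⟩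

/-- The object `c`, in the application a circuit, may depend on the fixed value `a`; only the bound
must be uniform. -/
theorem exists_and_adv_bind_le {α β γ : Type} [Fintype α] {s : Set β} {P : PMF α}
    {f g : α → PMF β} {good : γ → Prop} {r : γ → ℝ}
    (h : ∀ a, ∃ c, good c ∧ adv s (f a) (g a) ≤ r c) :
    ∃ c, good c ∧ adv s (P.bind f) (P.bind g) ≤ r c :=
  let ⟨a, ha⟩ := exists_adv_bind_le s P f g
  let ⟨c, hc, hr⟩ := h a
  ⟨c, hc, ha.trans hr⟩

/-- `P` and `Q` are at total variation distance at most `ε`, in terms of randomized tests. -/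
def StatClose {α : Type} (ε : ℝ) (P Q : PMF α) : Prop :=
  ∀ {β : Type} (f : α → PMF β) (s : Set β), adv s (P.bind f) (Q.bind f) ≤ ε

theorem StatClose.adv_bind_le {α β : Type} [Fintype α] {ε δ : ℝ} {P Q : PMF α}
    (h : StatClose ε P Q) {s : Set β} {f g : α → PMF β} (hfg : ∀ a, adv s (f a) (g a) ≤ δ) :
    adv s (P.bind f) (Q.bind g) ≤ ε + δ :=
  (adv_triangle s _ _ _).trans (add_le_add (h f s) (SecureMult.adv_bind_le Q hfg))

/-! ### Reindexing and independent samples -/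

theorem bind_equiv {α α' β : Type} {P : PMF α} {Q : PMF α'} (e : α ≃ α') (h : ∀ a, P a = Q (e a))
    (f : α' → PMF β) : P.bind (fun a => f (e a)) = Q.bind f := by
  ext b
  rw [PMF.bind_apply, PMF.bind_apply, ← e.tsum_eq]
  simp [h]

theorem uniform_bind_equiv {α α' β : Type} [Fintype α] [Nonempty α] [Fintype α'] [Nonempty α']
    (e : α ≃ α') (f : α' → PMF β) :
    (PMF.uniformOfFintype α).bind (fun a => f (e a)) = (PMF.uniformOfFintype α').bind f :=
  bind_equiv e (by simp [Fintype.card_congr e]) f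

/-- The product distribution. -/
def prodPMF {α β : Type} (P : PMF α) (Q : PMF β) : PMF (α × β) :=
  P.bind fun a => Q.map fun b => (a, b)

theorem prodPMF_bind {α β γ : Type} (P : PMF α) (Q : PMF β) (f : α × β → PMF γ) :
    (prodPMF P Q).bind f = P.bind fun a => Q.bind fun b => f (a, b) := by
  simp [prodPMF, PMF.bind_bind, PMF.bind_map, Function.comp_def]

theorem prodPMF_apply {α β : Type} (P : PMF α) (Q : PMF β) (x : α × β) :
    prodPMF P Q x = P x.1 * Q x.2 := by
  classical
  obtain ⟨a, b⟩ := x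
  rw [prodPMF, PMF.bind_apply, tsum_eq_single a]
  · rw [PMF.map_apply, tsum_eq_single b]
    · simp
    · intro b' hb
      simp [hb.symm]
  · intro a' ha
    rw [PMF.map_apply]
    simp [ha.symm]

theorem uniform_bind_prod {α β γ : Type} [Fintype α] [Nonempty α] [Fintype β] [Nonempty β]
    (f : α → β → PMF γ) :
    ((PMF.uniformOfFintype α).bind fun a => (PMF.uniformOfFintype β).bind (f a)) =
      (PMF.uniformOfFintype (α × β)).bind fun x => f x.1 x.2 := by
  rw [← prodPMF_bind (f := fun x => f x.1 x.2)]
  congr 1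
  ext x
  rw [prodPMF_apply]
  simp [ENNReal.mul_inv]

/-- A family of independent samples of `μ`. -/
def iid (ι : Type) [Fintype ι] [DecidableEq ι] {α : Type} [Fintype α] (μ : PMF α) : PMF (ι → α) :=
  PMF.ofFintype (fun x => ∏ i, μ (x i)) (by
    have h : ∑ a, μ a = 1 := by rw [← tsum_fintype (L := .unconditional _), μ.tsum_coe]
    rw [← Fintype.piFinset_univ, ← Finset.prod_univ_sum]
    simp [h])

theorem iid_apply (ι : Type) [Fintype ι] [DecidableEq ι] {α : Type} [Fintype α] (μ : PMF α)
    (x : ι → α) : iid ι μ x = ∏ i, μ (x i) := rfl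

theorem iid_uniform (ι : Type) [Fintype ι] [DecidableEq ι] (α : Type) [Fintype α] [Nonempty α] :
    iid ι (PMF.uniformOfFintype α) = PMF.uniformOfFintype (ι → α) := by
  ext x
  simp [iid_apply, ENNReal.inv_pow]

/-- Resampling one coordinate does not change a product distribution. It isolates the coordinate in
which two neighbouring hybrids differ. -/
theorem iid_bind_update {ι α β : Type} [Fintype ι] [DecidableEq ι] [Fintype α] (μ : PMF α) (j : ι)
    (f : (ι → α) → PMF β) :
    (iid ι μ).bind f =
      (iid ι μ).bind fun x => μ.bind fun a => f (Function.update x j a) := by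
  have hs : ∀ x : α × ({i // i ≠ j} → α),
      prodPMF μ (iid {i // i ≠ j} μ) x = iid ι μ ((Equiv.funSplitAt j α).symm x) := by
    intro x
    rw [prodPMF_apply, iid_apply, iid_apply, Fintype.prod_eq_mul_prod_subtype_ne _ j]
    congr 1
    · simp [Equiv.funSplitAt]
    · exact Finset.prod_congr rfl fun i _ => by simp [Equiv.funSplitAt, i.2]
  have hu : ∀ (b a : α) (y : {i // i ≠ j} → α),
      Function.update ((Equiv.funSplitAt j α).symm (b, y)) j a =
        (Equiv.funSplitAt j α).symm (a, y) := by
    intro b a y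
    ext i
    by_cases h : i = j <;> simp [Equiv.funSplitAt, Function.update_apply, h]
  rw [← bind_equiv _ hs, ← bind_equiv _ hs, prodPMF_bind, prodPMF_bind]
  simp only [hu]
  rw [PMF.bind_const, PMF.bind_comm]

/-- The hybrid argument: replacing `d` independent columns `g₁ ω ξ`, `ξ ← π₁`, by columns `g₂ ω ξ`,
`ξ ← π₂`, is detected with at most `d` times the advantage that a single replaced column gives when
the seeds of all the others are suitably fixed. -/
theorem hybrid {Ω Ξ₁ Ξ₂ α β : Type} [Fintype Ξ₁] [Fintype Ξ₂] {d : ℕ} (hd : 0 < d) (P : PMF Ω)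
    (π₁ : PMF Ξ₁) (π₂ : PMF Ξ₂) (g₁ : Ω → Ξ₁ → α) (g₂ : Ω → Ξ₂ → α)
    (G : Ω → (Fin d → α) → PMF β) (s : Set β) :
    ∃ (j : Fin d) (ξ₁ : Fin d → Ξ₁) (ξ₂ : Fin d → Ξ₂),
      adv s (P.bind fun ω => (iid (Fin d) π₁).bind fun ξ => G ω fun i => g₁ ω (ξ i))
        (P.bind fun ω => (iid (Fin d) π₂).bind fun ξ => G ω fun i => g₂ ω (ξ i)) ≤
      d * adv s
        (P.bind fun ω => π₁.bind fun a => G ω (Function.update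
          (fun i => if i < j then g₂ ω (ξ₂ i) else g₁ ω (ξ₁ i)) j (g₁ ω a)))
        (P.bind fun ω => π₂.bind fun a => G ω (Function.update
          (fun i => if i < j then g₂ ω (ξ₂ i) else g₁ ω (ξ₁ i)) j (g₂ ω a))) := by
  set L : Fin d → (Fin d → Ξ₁) → (Fin d → Ξ₂) → PMF β := fun j ξ₁ ξ₂ =>
    P.bind fun ω => π₁.bind fun a => G ω (Function.update
      (fun i => if i < j then g₂ ω (ξ₂ i) else g₁ ω (ξ₁ i)) j (g₁ ω a)) with hL
  set R : Fin d → (Fin d → Ξ₁) → (Fin d → Ξ₂) → PMF β := fun j ξ₁ ξ₂ =>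
    P.bind fun ω => π₂.bind fun a => G ω (Function.update
      (fun i => if i < j then g₂ ω (ξ₂ i) else g₁ ω (ξ₁ i)) j (g₂ ω a)) with hR
  -- In hybrid `j` the first `j` columns are of the second kind. Both families of seeds are sampled
  -- in full, so that neighbouring hybrids share all seeds except the one at position `j`.
  set H : ℕ → PMF β := fun j => (iid (Fin d) π₁).bind fun ξ₁ => (iid (Fin d) π₂).bind fun ξ₂ =>
    P.bind fun ω => G ω fun i => if (i : ℕ) < j then g₂ ω (ξ₂ i) else g₁ ω (ξ₁ i) with hH
  have h0 : H 0 = P.bind fun ω => (iid (Fin d) π₁).bind fun ξ => G ω fun i => g₁ ω (ξ i) := by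
    simp only [hH, Nat.not_lt_zero, if_false, PMF.bind_const]
    rw [PMF.bind_comm]
  have h1 : H d = P.bind fun ω => (iid (Fin d) π₂).bind fun ξ => G ω fun i => g₂ ω (ξ i) := by
    simp only [hH, Fin.is_lt, if_true, PMF.bind_const]
    rw [PMF.bind_comm]
  have hl : ∀ j : Fin d, H j = (iid (Fin d) π₁).bind fun ξ₁ => (iid (Fin d) π₂).bind (L j ξ₁) := by
    intro j
    simp only [hH]
    rw [iid_bind_update π₁ j]
    congr 1
    funext ξ₁
    rw [PMF.bind_comm]
    congr 1
    funext ξ₂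
    rw [PMF.bind_comm]
    simp only [hL]
    congr 1
    funext ω
    congr 1
    funext a
    congr 1
    funext i
    by_cases hi : i = j
    · subst hi; simp
    · simp [hi]
  have hr : ∀ j : Fin d,
      H (j + 1) = (iid (Fin d) π₁).bind fun ξ₁ => (iid (Fin d) π₂).bind (R j ξ₁) := by
    intro j
    simp only [hH]
    congr 1
    funext ξ₁
    rw [iid_bind_update π₂ j]
    congr 1
    funext ξ₂
    rw [PMF.bind_comm]
    simp only [hR]
    congr 1
    funext ω
    congr 1
    funext a
    congr 1
    funext i
    by_cases hi : i = j
    · subst hi; simp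
    · have : (i : ℕ) < j + 1 ↔ i < j := by
        rw [Fin.lt_def]
        have := Fin.val_ne_of_ne hi
        omega
      simp [hi, this]
  have hex : ∀ j : Fin d, ∃ ξ₁ ξ₂, adv s (H j) (H (j + 1)) ≤ adv s (L j ξ₁ ξ₂) (R j ξ₁ ξ₂) := by
    intro j
    rw [hl, hr]
    obtain ⟨ξ₁, h₁⟩ := exists_adv_bind_le s (iid (Fin d) π₁)
      (fun ξ₁ => (iid (Fin d) π₂).bind (L j ξ₁)) (fun ξ₁ => (iid (Fin d) π₂).bind (R j ξ₁))
    obtain ⟨ξ₂, h₂⟩ := exists_adv_bind_le s (iid (Fin d) π₂) (L j ξ₁) (R j ξ₁)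
    exact ⟨ξ₁, ξ₂, h₁.trans h₂⟩
  -- The `d` steps telescope, and each is bounded by the largest one; its index is the `j` of the
  -- statement.
  obtain ⟨j, -, hj⟩ := Finset.exists_max_image Finset.univ
    (fun j : Fin d => adv s (H j) (H (j + 1))) ⟨⟨0, hd⟩, Finset.mem_univ _⟩
  obtain ⟨ξ₁, ξ₂, h⟩ := hex j
  refine ⟨j, ξ₁, ξ₂, ?_⟩
  rw [← h0, ← h1]
  have hsum : ∀ k ≤ d, adv s (H 0) (H k) ≤ k * adv s (H j) (H (j + 1)) := by
    intro k hk
    induction k with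
    | zero => simp [adv_self]
    | succ k ih =>
      have := hj ⟨k, hk⟩ (Finset.mem_univ _)
      calc adv s (H 0) (H (k + 1)) ≤ adv s (H 0) (H k) + adv s (H k) (H (k + 1)) :=
            adv_triangle _ _ _ _
        _ ≤ k * adv s (H j) (H (j + 1)) + adv s (H j) (H (j + 1)) :=
            add_le_add (ih (by omega)) this
        _ = _ := by push_cast; ring
  exact (hsum d le_rfl).trans (by gcongr)

/-! ### Discrete Gaussians modulo `q` -/

theorem tsum_gauss_one_ne_top {σ : ℝ} (hσ : 0 < σ) :
    ∑' z : ℤ, ENNReal.ofReal (Real.exp (-Real.pi * (z : ℝ) ^ 2 / σ ^ 2)) ≠ ⊤ := by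
  rw [← ENNReal.ofReal_tsum_of_nonneg (fun x => (Real.exp_pos _).le) (summable_gauss_int hσ)]
  exact ENNReal.ofReal_ne_top

theorem tsum_gauss_one_ne_zero (σ : ℝ) :
    ∑' z : ℤ, ENNReal.ofReal (Real.exp (-Real.pi * (z : ℝ) ^ 2 / σ ^ 2)) ≠ 0 := by
  intro h
  have := ENNReal.tsum_eq_zero.1 h 0
  rw [ENNReal.ofReal_eq_zero] at this
  exact absurd this (not_le.2 (Real.exp_pos _))

/-- The discrete Gaussian distribution over `ℤ`. -/
def gaussInt (σ : ℝ) (hσ : 0 < σ) : PMF ℤ :=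
  PMF.normalize (fun z => ENNReal.ofReal (Real.exp (-Real.pi * (z : ℝ) ^ 2 / σ ^ 2)))
    (tsum_gauss_one_ne_zero σ) (tsum_gauss_one_ne_top hσ)

/-- The discrete Gaussian distribution over `ℤ`, reduced modulo `q`. -/
def gaussMod (q : ℕ) (σ : ℝ) (hσ : 0 < σ) : PMF (ZMod q) :=
  (gaussInt σ hσ).map fun z : ℤ => (z : ZMod q)

/-- The weight factors over the coordinates, so the point masses of the two measures are
proportional. Both have total mass one, which forces the constants to agree; the sum over `ι → ℤ`
need not be evaluated. -/
theorem discreteGaussian_toMeasure (ι : Type) [Fintype ι] {σ : ℝ} (hσ : 0 < σ) :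
    (discreteGaussian ι σ hσ).toMeasure =
      MeasureTheory.Measure.pi fun _ : ι => (gaussInt σ hσ).toMeasure := by
  set ν := MeasureTheory.Measure.pi fun _ : ι => (gaussInt σ hσ).toMeasure with hν
  set c := ∑' z : ℤ, ENNReal.ofReal (Real.exp (-Real.pi * (z : ℝ) ^ 2 / σ ^ 2)) with hc
  set w := ∑' x : ι → ℤ, ENNReal.ofReal (gaussWeight σ x) with hw
  have hsing : ∀ x, ν {x} = ENNReal.ofReal (gaussWeight σ x) * (c⁻¹) ^ Fintype.card ι := by
    intro x
    rw [hν, MeasureTheory.Measure.pi_singleton, gaussWeight_eq_prod,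
      ENNReal.ofReal_prod_of_nonneg fun i _ => (Real.exp_pos _).le]
    simp only [PMF.toMeasure_apply_singleton, measurableSet_singleton, gaussInt,
      PMF.normalize_apply]
    rw [Finset.prod_mul_distrib, Finset.prod_const, Finset.card_univ]
  have htot : w * (c⁻¹) ^ Fintype.card ι = 1 := by
    rw [hw, ← ENNReal.tsum_mul_right, ← MeasureTheory.measure_univ (μ := ν),
      ← MeasureTheory.Measure.tsum_indicator_apply_singleton ν Set.univ MeasurableSet.univ]
    simp [hsing]
  refine MeasureTheory.Measure.ext_of_singleton fun x => ?_
  rw [hsing, PMF.toMeasure_apply_singleton _ _ (measurableSet_singleton _), discreteGaussian,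
    PMF.normalize_apply]
  congr 1
  change w⁻¹ = _
  rw [ENNReal.eq_inv_of_mul_eq_one_left htot, inv_inv]

/-- The fibres of reduction modulo `q` are boxes, so independence of the coordinates survives. This
allows Gaussian matrices to be cut into columns and errors to be stacked. -/
theorem discreteGaussian_map_cast (ι : Type) [Fintype ι] [DecidableEq ι] (q : ℕ) [NeZero q] {σ : ℝ}
    (hσ : 0 < σ) :
    (discreteGaussian ι σ hσ).map (fun x i => (x i : ZMod q)) = iid ι (gaussMod q σ hσ) := by
  ext y
  have hpre : (fun (x : ι → ℤ) i => (x i : ZMod q)) ⁻¹' {y} =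
      Set.univ.pi fun i => (fun z : ℤ => (z : ZMod q)) ⁻¹' {y i} := by
    ext x
    simp [funext_iff]
  rw [← PMF.toOuterMeasure_apply_singleton, PMF.toOuterMeasure_map_apply, hpre,
    ← PMF.toMeasure_apply_eq_toOuterMeasure, discreteGaussian_toMeasure,
    MeasureTheory.Measure.pi_pi, iid_apply]
  refine Finset.prod_congr rfl fun i _ => ?_
  rw [gaussMod, ← PMF.toOuterMeasure_apply_singleton _ (y i), PMF.toOuterMeasure_map_apply,
    PMF.toMeasure_apply_eq_toOuterMeasure]

/-! ### The leftover hash lemma for ternary vectors -/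

/-- A ternary vector, regarded modulo `q`. -/
def ternaryVec {a : ℕ} (q : ℕ) (r : Fin a → ZMod 3) : Fin a → ZMod q :=
  fun i => (centered (r i) : ZMod q)

/-- No difference of corresponding entries is `±1`. -/
def NoUnitDiff {t : ℕ} (r r' : Fin t → ZMod 3) : Prop :=
  ∀ i, ¬ (centered (r i) - centered (r' i) = 1 ∨ centered (r i) - centered (r' i) = -1)

instance {t : ℕ} (r r' : Fin t → ZMod 3) : Decidable (NoUnitDiff r r') :=
  inferInstanceAs (Decidable (∀ _, _))

/-- In each coordinate 5 of the 9 pairs qualify: the three equal ones, `(1, -1)` and `(-1, 1)`. -/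
theorem card_noUnitDiff (t : ℕ) :
    Fintype.card {x : (Fin t → ZMod 3) × (Fin t → ZMod 3) // NoUnitDiff x.1 x.2} = 5 ^ t := by
  have e : {x : (Fin t → ZMod 3) × (Fin t → ZMod 3) // NoUnitDiff x.1 x.2} ≃
      (Fin t → {x : ZMod 3 × ZMod 3 //
        ¬ (centered x.1 - centered x.2 = 1 ∨ centered x.1 - centered x.2 = -1)}) :=
    { toFun := fun x i => ⟨(x.1.1 i, x.1.2 i), x.2 i⟩
      invFun := fun y => ⟨(fun i => (y i).1.1, fun i => (y i).1.2), fun i => (y i).2⟩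
      left_inv := fun x => rfl
      right_inv := fun y => rfl }
  rw [Fintype.card_congr e, Fintype.card_fun, Fintype.card_fin]
  congr 1

/-- The modulus may be composite, but an entry `±1` is always a unit. Adding a multiple of the
`i`-th coordinate row therefore moves `B *ᵥ z` to any prescribed value, so all fibres have the same
size. -/
theorem card_mulVec_eq {n t q : ℕ} [NeZero q] (z : Fin t → ZMod q) {i : Fin t}
    (hz : z i = 1 ∨ z i = -1) :
    Fintype.card {B : Matrix (Fin n) (Fin t) (ZMod q) // B *ᵥ z = 0} * q ^ n =
      Fintype.card (Matrix (Fin n) (Fin t) (ZMod q)) := by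
  obtain ⟨u, hu⟩ : ∃ u, u * z i = 1 := by
    rcases hz with h | h
    · exact ⟨1, by simp [h]⟩
    · exact ⟨-1, by simp [h]⟩
  have hS : ∀ w : Fin n → ZMod q,
      Matrix.vecMulVec w (Pi.single i u) *ᵥ z = w := by
    intro w
    rw [Matrix.vecMulVec_mulVec]
    simp [hu]
  have e : {B : Matrix (Fin n) (Fin t) (ZMod q) // B *ᵥ z = 0} × (Fin n → ZMod q) ≃
      Matrix (Fin n) (Fin t) (ZMod q) :=
    { toFun := fun x => x.1.1 + Matrix.vecMulVec x.2 (Pi.single i u)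
      invFun := fun B => (⟨B - Matrix.vecMulVec (B *ᵥ z) (Pi.single i u), by
        rw [Matrix.sub_mulVec, hS, sub_self]⟩, B *ᵥ z)
      left_inv := fun ⟨⟨B, hB⟩, w⟩ => by
        simp [Matrix.add_mulVec, hB, hS]
      right_inv := fun B => by simp }
  rw [← Fintype.card_congr e, Fintype.card_prod, Fintype.card_fun, ZMod.card, Fintype.card_fin]

/-- The number of collisions of the hash functions `r ↦ B r`, over all `B`. -/
theorem sum_collisions_le (n t q : ℕ) [NeZero q] :
    (∑ B : Matrix (Fin n) (Fin t) (ZMod q), ∑ r : Fin t → ZMod 3, ∑ r' : Fin t → ZMod 3,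
        if B *ᵥ ternaryVec q r = B *ᵥ ternaryVec q r' then (1 : ℝ) else 0) ≤
      Fintype.card (Matrix (Fin n) (Fin t) (ZMod q)) * (9 ^ t / q ^ n + 5 ^ t) := by
  set N : ℝ := (Fintype.card (Matrix (Fin n) (Fin t) (ZMod q)) : ℝ) with hN
  have hq : (0 : ℝ) < (q : ℝ) ^ n := by
    have : (0 : ℝ) < q := by exact_mod_cast Nat.pos_of_neZero q
    positivity
  have key : ∀ r r' : Fin t → ZMod 3,
      (∑ B : Matrix (Fin n) (Fin t) (ZMod q),
        if B *ᵥ ternaryVec q r = B *ᵥ ternaryVec q r' then (1 : ℝ) else 0) ≤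
      N * (1 / q ^ n + if NoUnitDiff r r' then 1 else 0) := by
    intro r r'
    by_cases h : NoUnitDiff r r'
    · rw [if_pos h]
      calc _ ≤ ∑ B : Matrix (Fin n) (Fin t) (ZMod q), (1 : ℝ) :=
            Finset.sum_le_sum fun B _ => by split_ifs <;> norm_num
        _ = N := by simp [hN]
        _ ≤ _ := by
            rw [mul_add, mul_one]
            exact le_add_of_nonneg_left (by positivity)
    · rw [if_neg h, add_zero]
      simp only [NoUnitDiff, not_forall, not_not] at h
      obtain ⟨i, hi⟩ := h
      have hz : (ternaryVec q r - ternaryVec q r') i = 1 ∨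
          (ternaryVec q r - ternaryVec q r') i = -1 := by
        simp only [Pi.sub_apply, ternaryVec, ← Int.cast_sub]
        rcases hi with hi | hi <;> rw [hi] <;> simp
      have hc := card_mulVec_eq (n := n) _ hz
      have : (∑ B : Matrix (Fin n) (Fin t) (ZMod q),
          if B *ᵥ ternaryVec q r = B *ᵥ ternaryVec q r' then (1 : ℝ) else 0) =
          Fintype.card {B : Matrix (Fin n) (Fin t) (ZMod q) //
            B *ᵥ (ternaryVec q r - ternaryVec q r') = 0} := by
        rw [Fintype.card_subtype, Finset.sum_boole]
        simp only [Matrix.mulVec_sub, sub_eq_zero]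
      rw [this, mul_one_div, le_div_iff₀ hq, hN, ← hc]
      push_cast
      rfl
  calc _ = ∑ r : Fin t → ZMod 3, ∑ r' : Fin t → ZMod 3,
        ∑ B : Matrix (Fin n) (Fin t) (ZMod q),
          if B *ᵥ ternaryVec q r = B *ᵥ ternaryVec q r' then (1 : ℝ) else 0 := by
        rw [Finset.sum_comm]
        exact Finset.sum_congr rfl fun r _ => Finset.sum_comm
    _ ≤ ∑ r : Fin t → ZMod 3, ∑ r' : Fin t → ZMod 3,
          N * (1 / q ^ n + if NoUnitDiff r r' then 1 else 0) :=
        Finset.sum_le_sum fun r _ => Finset.sum_le_sum fun r' _ => key r r'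
    _ = N * (9 ^ t / q ^ n + 5 ^ t) := by
        have h5 := card_noUnitDiff t
        rw [Fintype.card_subtype, Finset.card_filter] at h5
        have h5' : (∑ r : Fin t → ZMod 3, ∑ r' : Fin t → ZMod 3,
            if NoUnitDiff r r' then (1 : ℝ) else 0) = 5 ^ t := by
          rw [← Fintype.sum_prod_type' (f := fun r r' => if NoUnitDiff r r' then (1 : ℝ) else 0)]
          exact_mod_cast h5
        simp_rw [← Finset.mul_sum, Finset.sum_add_distrib, h5']
        simp only [Finset.sum_const, Finset.card_univ, Fintype.card_fun, Fintype.card_fin,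
          ZMod.card, nsmul_eq_mul]
        congr 2
        rw [← mul_assoc]
        push_cast
        rw [← mul_pow]
        norm_num
        rfl

/-- Cauchy–Schwarz bounds the squared advantage by `q ^ n` times the mean squared Euclidean distance
of the hash distribution from uniform, and the collision count bounds that distance by `(5 / 9) ^
t`. As `F` also receives `B`, the hash value looks uniform even when the matrix is known. -/
theorem leftover_hash {n t q : ℕ} [NeZero q] (hq : (q : ℝ) ^ (2 * n) ≤ 2 ^ t)
    {β : Type} (F : Matrix (Fin n) (Fin t) (ZMod q) → (Fin n → ZMod q) → PMF β) (s : Set β) :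
    adv s ((uniformMatrix n t q).bind fun B =>
        (PMF.uniformOfFintype (Fin t → ZMod 3)).bind fun r => F B (B *ᵥ ternaryVec q r))
      ((uniformMatrix n t q).bind fun B => (uniformVec n q).bind fun w => F B w) ^ 4 ≤
      ((q : ℝ) ^ n)⁻¹ := by
  set N : ℝ := (Fintype.card (Matrix (Fin n) (Fin t) (ZMod q)) : ℝ) with hN
  set Q : ℝ := (q : ℝ) ^ n with hQ
  set f : Matrix (Fin n) (Fin t) (ZMod q) → (Fin n → ZMod q) → ℝ := fun B w => prob s (F B w)
    with hf
  have hq0 : (0 : ℝ) < q := by exact_mod_cast Nat.pos_of_neZero q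
  have hQ0 : 0 < Q := by positivity
  have hN0 : 0 < N := by rw [hN]; exact_mod_cast Fintype.card_pos
  -- the distribution of the hash value
  set P : Matrix (Fin n) (Fin t) (ZMod q) → (Fin n → ZMod q) → ℝ := fun B w =>
    (3 ^ t)⁻¹ * ∑ r : Fin t → ZMod 3, if B *ᵥ ternaryVec q r = w then 1 else 0 with hP
  have hPf : ∀ B, ∑ w, P B w * f B w = (3 ^ t)⁻¹ * ∑ r, f B (B *ᵥ ternaryVec q r) := by
    intro B
    simp only [hP, mul_assoc, Finset.sum_mul, ← Finset.mul_sum]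
    rw [Finset.sum_comm]
    simp
  have hP1 : ∀ B, ∑ w, P B w = 1 := by
    intro B
    simp only [hP, ← Finset.mul_sum]
    rw [Finset.sum_comm]
    simp
  have hP2 : ∀ B, ∑ w, P B w ^ 2 = (9 ^ t)⁻¹ * ∑ r : Fin t → ZMod 3, ∑ r' : Fin t → ZMod 3,
      if B *ᵥ ternaryVec q r = B *ᵥ ternaryVec q r' then (1 : ℝ) else 0 := by
    intro B
    have h9 : ((9 : ℝ) ^ t)⁻¹ = (3 ^ t)⁻¹ ^ 2 := by
      rw [inv_pow, ← pow_mul, mul_comm t, pow_mul]; norm_num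
    simp only [hP, mul_pow, ← Finset.mul_sum, h9]
    congr 1
    simp only [sq, Finset.sum_mul_sum]
    rw [Finset.sum_comm]
    refine Finset.sum_congr rfl fun r _ => ?_
    rw [Finset.sum_comm]
    refine Finset.sum_congr rfl fun r' _ => ?_
    simp [eq_comm]
  have hcard : Fintype.card (Fin n → ZMod q) = q ^ n := by simp
  have hd2 : ∀ B, ∑ w, (P B w - Q⁻¹) ^ 2 = ∑ w, P B w ^ 2 - Q⁻¹ := by
    intro B
    have : ∀ w, (P B w - Q⁻¹) ^ 2 = P B w ^ 2 - 2 * Q⁻¹ * P B w + Q⁻¹ ^ 2 := fun w => by ring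
    simp only [this, Finset.sum_add_distrib, Finset.sum_sub_distrib, ← Finset.mul_sum, hP1]
    simp only [Finset.sum_const, Finset.card_univ, hcard, nsmul_eq_mul, Nat.cast_pow, ← hQ]
    field_simp
    ring
  have hsum : ∑ B, ∑ w, (P B w - Q⁻¹) ^ 2 ≤ N * (5 / 9) ^ t := by
    simp only [hd2, hP2, Finset.sum_sub_distrib, ← Finset.mul_sum]
    have hc := sum_collisions_le n t q
    rw [← hN, ← hQ] at hc
    have h9 : (0 : ℝ) < 9 ^ t := by positivity
    have := mul_le_mul_of_nonneg_left hc (inv_nonneg.2 h9.le)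
    -- The term `9 ^ t / q ^ n` of the collision bound is the collision rate of the uniform
    -- distribution and cancels against `Q⁻¹`; only the exceptional pairs remain.
    refine (sub_le_sub_right this _).trans (le_of_eq ?_)
    simp only [Finset.sum_const, Finset.card_univ, nsmul_eq_mul, ← hN, div_pow]
    field_simp
    ring
  have hadv : adv s ((uniformMatrix n t q).bind fun B =>
        (PMF.uniformOfFintype (Fin t → ZMod 3)).bind fun r => F B (B *ᵥ ternaryVec q r))
      ((uniformMatrix n t q).bind fun B => (uniformVec n q).bind fun w => F B w) =
      |N⁻¹ * ∑ B, ∑ w, (P B w - Q⁻¹) * f B w| := by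
    rw [adv]
    congr 1
    simp only [prob_bind, sub_mul, Finset.sum_sub_distrib, hPf, uniformMatrix, uniformVec,
      PMF.uniformOfFintype_apply, ENNReal.toReal_inv, ENNReal.toReal_natCast, hcard,
      ← Finset.mul_sum, mul_sub]
    simp [hN, hQ, hf]
  have hcs : (∑ B, ∑ w, (P B w - Q⁻¹) * f B w) ^ 2 ≤ (N * (5 / 9) ^ t) * (N * Q) := by
    have h := Finset.sum_mul_sq_le_sq_mul_sq (Finset.univ)
      (fun x : Matrix (Fin n) (Fin t) (ZMod q) × (Fin n → ZMod q) => P x.1 x.2 - Q⁻¹)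
      (fun x => f x.1 x.2)
    rw [Fintype.sum_prod_type, Fintype.sum_prod_type] at h
    refine h.trans (mul_le_mul hsum ?_ (by positivity) (by positivity))
    calc ∑ x : Matrix (Fin n) (Fin t) (ZMod q) × (Fin n → ZMod q), f x.1 x.2 ^ 2
        ≤ ∑ x : Matrix (Fin n) (Fin t) (ZMod q) × (Fin n → ZMod q), (1 : ℝ) :=
          Finset.sum_le_sum fun x _ => pow_le_one₀ (prob_nonneg _ _) (prob_le_one _ _)
      _ = N * Q := by
          rw [Finset.sum_const, Finset.card_univ, Fintype.card_prod, hcard]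
          simp [hN, hQ]
  have hsq : |N⁻¹ * ∑ B, ∑ w, (P B w - Q⁻¹) * f B w| ^ 2 ≤ (5 / 9) ^ t * Q := by
    rw [sq_abs, mul_pow]
    calc _ ≤ N⁻¹ ^ 2 * ((N * (5 / 9) ^ t) * (N * Q)) := by gcongr
      _ = _ := by field_simp
  rw [hadv]
  have h4 : |N⁻¹ * ∑ B, ∑ w, (P B w - Q⁻¹) * f B w| ^ 4 ≤ ((5 / 9) ^ t * Q) ^ 2 := by
    calc _ = (|N⁻¹ * ∑ B, ∑ w, (P B w - Q⁻¹) * f B w| ^ 2) ^ 2 := by ring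
      _ ≤ _ := by gcongr
  refine h4.trans ?_
  have h2 : Q ^ 2 ≤ 2 ^ t := by rw [hQ, ← pow_mul, mul_comm n]; exact hq
  -- The numerical input is `(5 / 9) ^ 4 ≤ (1 / 2) ^ 3`. With `Q ^ 2 ≤ 2 ^ t` it gives `(5 / 9) ^ (2
  -- * t) ≤ Q ^ (-3)`, which beats the factor `Q ^ 2` and leaves `Q⁻¹`.
  have h3 : ((5 / 9 : ℝ) ^ t) ^ 4 ≤ ((2 ^ t)⁻¹) ^ 3 := by
    rw [← pow_mul, inv_pow, ← pow_mul, ← inv_pow, mul_comm t 4, mul_comm t 3, pow_mul, pow_mul]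
    gcongr
    norm_num
  have h5 : ((5 / 9 : ℝ) ^ t) ^ 4 ≤ ((Q ^ 3)⁻¹) ^ 2 := by
    refine h3.trans ?_
    rw [inv_pow, inv_pow, ← pow_mul Q, mul_comm 3 2, pow_mul Q]
    gcongr
  have h6 : ((5 / 9 : ℝ) ^ t) ^ 2 ≤ (Q ^ 3)⁻¹ := by
    refine le_of_sq_le_sq (le_of_eq_of_le ?_ h5) (by positivity)
    ring
  calc ((5 / 9) ^ t * Q) ^ 2 = ((5 / 9 : ℝ) ^ t) ^ 2 * Q ^ 2 := by ring
    _ ≤ (Q ^ 3)⁻¹ * Q ^ 2 := by gcongr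
    _ = Q⁻¹ := by field_simp

/-- A matrix, given by its columns. -/
def colEquiv (a d : ℕ) (α : Type) : (Fin d → Fin a → α) ≃ Matrix (Fin a) (Fin d) α where
  toFun c := Matrix.of fun i j => c j i
  invFun M := fun j i => M i j
  left_inv _ := rfl
  right_inv _ := rfl

@[simp]
theorem colEquiv_apply {a d : ℕ} {α : Type} (c : Fin d → Fin a → α) (i : Fin a) (j : Fin d) :
    colEquiv a d α c i j = c j i := rfl

theorem leftover_hash_matrix {n t q : ℕ} [NeZero q] (hq : (q : ℝ) ^ (2 * n) ≤ 2 ^ t) {ε : ℝ}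
    (hε : 0 ≤ ε) (h : n ≠ 0 → ((q : ℝ) ^ n)⁻¹ ≤ ε ^ 4) (d : ℕ) {β : Type}
    (F : Matrix (Fin n) (Fin t) (ZMod q) → Matrix (Fin n) (Fin d) (ZMod q) → PMF β) (s : Set β) :
    adv s ((uniformMatrix n t q).bind fun B =>
        (uniformMatrix t d 3).bind fun R => F B (B * ternary q R))
      ((uniformMatrix n t q).bind fun B => (uniformMatrix n d q).bind fun W => F B W) ≤ d * ε := by
  -- A matrix without entries carries no information. The case `n = 0` is separate because then `(q
  -- ^ n)⁻¹ = 1` is not small; `d = 0` because `hybrid` needs a column.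
  by_cases hnd : n = 0 ∨ d = 0
  · have : Subsingleton (Matrix (Fin n) (Fin d) (ZMod q)) := by
      rcases hnd with rfl | rfl
      · exact ⟨fun a b => by ext i; exact i.elim0⟩
      · exact ⟨fun a b => by ext _ j; exact j.elim0⟩
    have h0 : ∀ B W, F B W = F B 0 := fun B W => by rw [Subsingleton.elim W 0]
    simp only [h0 _ _, PMF.bind_const, adv_self]
    positivity
  · push Not at hnd
    obtain ⟨j, ξ₁, ξ₂, hj⟩ := hybrid (Nat.pos_of_ne_zero hnd.2) (uniformMatrix n t q)
      (PMF.uniformOfFintype (Fin t → ZMod 3)) (uniformVec n q)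
      (fun B r => B *ᵥ ternaryVec q r) (fun _ w => w)
      (fun B c => F B (colEquiv n d _ c)) s
    simp only [uniformVec, iid_uniform] at hj
    have e1 : ∀ B : Matrix (Fin n) (Fin t) (ZMod q),
        ((PMF.uniformOfFintype (Fin d → Fin t → ZMod 3)).bind fun ξ =>
          F B (colEquiv n d _ fun i => B *ᵥ ternaryVec q (ξ i))) =
        (uniformMatrix t d 3).bind fun R => F B (B * ternary q R) := fun B =>
      uniform_bind_equiv (colEquiv t d (ZMod 3)) fun R => F B (B * ternary q R)
    have e2 : ∀ B : Matrix (Fin n) (Fin t) (ZMod q),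
        ((PMF.uniformOfFintype (Fin d → Fin n → ZMod q)).bind fun ξ => F B (colEquiv n d _ ξ)) =
        (uniformMatrix n d q).bind fun W => F B W := fun B =>
      uniform_bind_equiv (colEquiv n d (ZMod q)) fun W => F B W
    simp only [e1, e2] at hj
    refine hj.trans (mul_le_mul_of_nonneg_left ?_ (Nat.cast_nonneg d))
    refine le_of_pow_le_pow_left₀ (n := 4) (by norm_num) hε (le_trans ?_ (h hnd.1))
    exact leftover_hash hq (fun B w => F B (colEquiv n d _ (Function.update
      (fun i => if i < j then ξ₂ i else B *ᵥ ternaryVec q (ξ₁ i)) j w))) s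

/-! ### Straight-line programs of Boolean functions -/

/-- The functions that can be read off once those in the list `L` have been computed: the inputs,
the constants and the members of `L`. -/
def Avail {ι : Type} (L : List ((ι → Bool) → Bool)) : Set ((ι → Bool) → Bool) :=
  {f | (∃ i, f = fun x => x i) ∨ (∃ b, f = fun _ => b) ∨ f ∈ L}

theorem avail_mono {ι : Type} {L L' : List ((ι → Bool) → Bool)} (h : L ⊆ L') :
    Avail L ⊆ Avail L' := fun _ hf => hf.imp_right (Or.imp_right fun hm => h hm)

theorem avail_subset_append {ι : Type} (L L' : List ((ι → Bool) → Bool)) :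
    Avail L ⊆ Avail (L ++ L') := avail_mono (List.subset_append_left _ _)

/-- Each function in the list is the NAND of two functions that are available before. -/
inductive Chain {ι : Type} : List ((ι → Bool) → Bool) → Prop
  | nil : Chain []
  | snoc {L : List ((ι → Bool) → Bool)} {f g : (ι → Bool) → Bool} :
      Chain L → f ∈ Avail L → g ∈ Avail L → Chain (L ++ [fun x => !(f x && g x)])

/-- Once the functions in `T` are available, those in `U` can be computed with `s` more gates. -/
def Adds {ι : Type} (s : ℕ) (T U : Set ((ι → Bool) → Bool)) : Prop :=
  ∀ L, Chain L → T ⊆ Avail L → ∃ L', Chain (L ++ L') ∧ L'.length ≤ s ∧ U ⊆ Avail (L ++ L')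

section Adds

variable {ι : Type} {s s' : ℕ} {T T' U V : Set ((ι → Bool) → Bool)} {f g h : (ι → Bool) → Bool}

theorem Adds.mono (hs : s ≤ s') (hT : T ⊆ T') (H : Adds s T U) : Adds s' T' U := fun L hL hTL =>
  let ⟨L', h1, h2, h3⟩ := H L hL (hT.trans hTL)
  ⟨L', h1, h2.trans hs, h3⟩

/-- Programs can be stacked because `Adds` quantifies over every program already present: the second
one is run after the first and reuses its results. -/
theorem Adds.trans (H : Adds s T U) (H' : Adds s' (T ∪ U) V) : Adds (s + s') T V := by
  intro L hL hTL
  obtain ⟨L₁, h1, h2, h3⟩ := H L hL hTL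
  obtain ⟨L₂, k1, k2, k3⟩ := H' (L ++ L₁) h1
    (Set.union_subset (hTL.trans (avail_subset_append _ _)) h3)
  refine ⟨L₁ ++ L₂, by rwa [← List.append_assoc], ?_, by rwa [← List.append_assoc]⟩
  rw [List.length_append]
  omega

theorem Adds.union (H : Adds s T U) (H' : Adds s' T V) : Adds (s + s') T (U ∪ V) := by
  intro L hL hTL
  obtain ⟨L₁, h1, h2, h3⟩ := H L hL hTL
  obtain ⟨L₂, k1, k2, k3⟩ := H' (L ++ L₁) h1 (hTL.trans (avail_subset_append _ _))
  refine ⟨L₁ ++ L₂, by rwa [← List.append_assoc], ?_, ?_⟩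
  · rw [List.length_append]
    omega
  · rw [← List.append_assoc]
    exact Set.union_subset (h3.trans (avail_subset_append _ _)) k3

theorem Adds.range {o : Type} [Fintype o] {F : o → (ι → Bool) → Bool}
    (H : ∀ j, Adds s T {F j}) : Adds (Fintype.card o * s) T (Set.range F) := by
  classical
  have key : ∀ J : Finset o, Adds (J.card * s) T (F '' J) := by
    intro J
    induction J using Finset.induction_on with
    | empty => exact fun L hL _ => ⟨[], by simpa using hL, by simp, by simp⟩
    | insert j J hj ih =>
      rw [Finset.card_insert_of_notMem hj, Finset.coe_insert, Set.image_insert_eq, Set.insert_eq,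
        Nat.succ_mul, Nat.add_comm]
      exact (H j).union ih
  simpa using key Finset.univ

theorem Adds.of_mem (hf : f ∈ T) : Adds 0 T {f} := fun L hL hTL =>
  ⟨[], by simpa using hL, le_rfl, by simpa using hTL hf⟩

theorem Adds.input (i : ι) : Adds 0 T {fun x => x i} := fun L hL _ =>
  ⟨[], by simpa using hL, le_rfl, Set.singleton_subset_iff.2 (Or.inl ⟨i, rfl⟩)⟩

theorem Adds.const (b : Bool) : Adds 0 T {fun _ => b} := fun L hL _ =>
  ⟨[], by simpa using hL, le_rfl, Set.singleton_subset_iff.2 (Or.inr (Or.inl ⟨b, rfl⟩))⟩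

theorem Adds.nand_of_mem (hf : f ∈ T) (hg : g ∈ T) : Adds 1 T {fun x => !(f x && g x)} :=
  fun _ hL hTL => ⟨[fun x => !(f x && g x)], Chain.snoc hL (hTL hf) (hTL hg), le_rfl, by
    rw [Set.singleton_subset_iff]
    exact Or.inr (Or.inr (by simp))⟩

theorem Adds.nand (hf : Adds s T {f}) (hg : Adds s' T {g}) :
    Adds (s + s' + 1) T {fun x => !(f x && g x)} :=
  (hf.union hg).trans (Adds.nand_of_mem (by simp) (by simp))

theorem Adds.not (hf : Adds s T {f}) : Adds (s + 1) T {fun x => !f x} := by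
  simpa using hf.trans (Adds.nand_of_mem (f := f) (g := f) (by simp) (by simp))

theorem Adds.and (hf : Adds s T {f}) (hg : Adds s' T {g}) :
    Adds (s + s' + 2) T {fun x => f x && g x} := by
  simpa using (hf.nand hg).not

theorem Adds.or (hf : Adds s T {f}) (hg : Adds s' T {g}) :
    Adds (s + s' + 3) T {fun x => f x || g x} := by
  have := hf.not.nand hg.not
  simp only [Bool.not_and, Bool.not_not] at this
  exact this.mono (by omega) subset_rfl

theorem Adds.mux {a : ℕ} (hh : Adds a T {h}) (hf : Adds s T {f}) (hg : Adds s' T {g}) :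
    Adds (2 * a + s + s' + 4) T {fun x => if h x then f x else g x} := by
  have := (hh.nand hf).nand (hh.not.nand hg)
  have e : (fun x => !(!(h x && f x) && !((!h x) && g x))) = fun x => if h x then f x else g x := by
    funext x
    cases h x <;> simp
  rw [e] at this
  exact this.mono (by omega) subset_rfl

theorem Adds.xor (hf : Adds s T {f}) (hg : Adds s' T {g}) :
    Adds (2 * s + 2 * s' + 5) T {fun x => f x ^^ g x} := by
  have := hf.mux hg.not hg
  have e : (fun x => if f x then !g x else g x) = fun x => f x ^^ g x := by
    funext x
    cases f x <;> simp
  rw [e] at this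
  exact this.mono (by omega) subset_rfl

end Adds

/-! ### From straight-line programs to circuits and back -/

theorem gateValues_append {ι : Type} (x : ι → Bool) (Γ : List (Wire ι × Wire ι))
    (g : Wire ι × Wire ι) :
    gateValues x (Γ ++ [g]) = gateValues x Γ ++
      [!(g.1.value x (gateValues x Γ) && g.2.value x (gateValues x Γ))] := by
  simp [gateValues, List.foldl_append]

theorem length_gateValues {ι : Type} (x : ι → Bool) (Γ : List (Wire ι × Wire ι)) :
    (gateValues x Γ).length = Γ.length := by
  induction Γ using List.reverseRecOn with
  | nil => rfl
  | append_singleton Γ g ih => rw [gateValues_append]; simp [ih]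

theorem exists_wire {ι : Type} {L : List ((ι → Bool) → Bool)} {f : (ι → Bool) → Bool}
    (hf : f ∈ Avail L) : ∃ w : Wire ι, ∀ x, w.value x (L.map fun g => g x) = f x := by
  rcases hf with ⟨i, rfl⟩ | ⟨b, rfl⟩ | hm
  · exact ⟨.input i, fun x => rfl⟩
  · exact ⟨.const b, fun x => rfl⟩
  · obtain ⟨k, hk, rfl⟩ := List.getElem_of_mem hm
    exact ⟨.gate k, fun x => by simp [Wire.value, List.getD, hk]⟩

theorem Chain.exists_gates {ι : Type} {L : List ((ι → Bool) → Bool)} (hL : Chain L) :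
    ∃ Γ : List (Wire ι × Wire ι), Γ.length = L.length ∧
      ∀ x, gateValues x Γ = L.map fun g => g x := by
  induction hL with
  | nil => exact ⟨[], rfl, fun x => rfl⟩
  | snoc _ hf hg ih =>
    obtain ⟨Γ, h1, h2⟩ := ih
    obtain ⟨w, hw⟩ := exists_wire hf
    obtain ⟨w', hw'⟩ := exists_wire hg
    exact ⟨Γ ++ [(w, w')], by simp [h1], fun x => by simp [gateValues_append, h2, hw, hw']⟩

theorem exists_circuit {ι o : Type} {s : ℕ} {F : (ι → Bool) → o → Bool}
    (H : Adds s ∅ (Set.range fun j x => F x j)) :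
    ∃ D : Circuit ι o, D.gates.length ≤ s ∧ ∀ x, D.eval x = F x := by
  obtain ⟨L, h1, h2, h3⟩ := H [] Chain.nil (Set.empty_subset _)
  obtain ⟨Γ, hΓ, hv⟩ := h1.exists_gates
  choose w hw using fun j => exists_wire (h3 (Set.mem_range_self j))
  refine ⟨⟨Γ, w⟩, by simpa [hΓ] using h2, fun x => ?_⟩
  funext j
  simp only [Circuit.eval, hv]
  exact hw j x

/-- The alternative `Γ.length ≤ k` covers references to gates not yet evaluated; they read `false`,
so a constant replaces them. -/
theorem Adds.wire {ι κ : Type} {T : Set ((ι → Bool) → Bool)} {F : (ι → Bool) → κ → Bool}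
    {Γ : List (Wire κ × Wire κ)}
    (hT : ∀ k, (fun x => (gateValues (F x) Γ).getD k false) ∈ T ∨ Γ.length ≤ k) (w : Wire κ) :
    Adds 0 (T ∪ Set.range fun j x => F x j) {fun x => w.value (F x) (gateValues (F x) Γ)} := by
  cases w with
  | input i => exact Adds.of_mem (Or.inr ⟨i, rfl⟩)
  | const b => exact Adds.const b
  | gate k =>
    rcases hT k with h | h
    · exact Adds.of_mem (Or.inl h)
    · have : (fun x => (Wire.gate k : Wire κ).value (F x) (gateValues (F x) Γ)) =
          fun _ => false := by
        funext x
        rw [Wire.value, List.getD_eq_default]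
        rwa [length_gateValues]
      rw [this]
      exact Adds.const false

/-- Replaying the gates of a circuit on the outputs of `F` costs one gate each, which makes the size
of a composite circuit additive. -/
theorem Adds.gates {ι κ : Type} (F : (ι → Bool) → κ → Bool) (Γ : List (Wire κ × Wire κ)) :
    Adds Γ.length (Set.range fun j x => F x j)
      {f | ∃ k < Γ.length, f = fun x => (gateValues (F x) Γ).getD k false} := by
  induction Γ using List.reverseRecOn with
  | nil => exact fun L hL _ => ⟨[], by simpa using hL, by simp, by simp⟩
  | append_singleton Γ g ih =>
    rw [List.length_append, List.length_singleton]
    set T := {f | ∃ k < Γ.length, f = fun x => (gateValues (F x) Γ).getD k false} with hT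
    have hT' : ∀ k, (fun x => (gateValues (F x) Γ).getD k false) ∈ T ∨ Γ.length ≤ k := fun k =>
      (lt_or_ge k Γ.length).imp_left fun h => ⟨k, h, rfl⟩
    have hn := ((Adds.wire hT' g.1).nand (Adds.wire hT' g.2))
    intro L hL hTL
    obtain ⟨L₁, h1, h2, h3⟩ := ih L hL hTL
    obtain ⟨L₂, k1, k2, k3⟩ := hn (L ++ L₁) h1
      (Set.union_subset h3 (hTL.trans (avail_subset_append _ _)))
    refine ⟨L₁ ++ L₂, by rwa [← List.append_assoc], by rw [List.length_append]; omega, ?_⟩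
    rw [← List.append_assoc]
    rintro f ⟨k, hk, rfl⟩
    rcases Nat.lt_succ_iff_lt_or_eq.1 hk with hk | rfl
    · refine avail_subset_append _ _ (h3 ⟨k, hk, ?_⟩)
      funext x
      rw [gateValues_append, List.getD_append _ _ _ _ (by rwa [length_gateValues])]
    · refine k3 ?_
      rw [Set.mem_singleton_iff]
      funext x
      rw [gateValues_append, List.getD_append_right _ _ _ _ (by rw [length_gateValues])]
      simp [length_gateValues]

theorem Adds.circuit {ι κ : Type} (F : (ι → Bool) → κ → Bool) (D : Circuit κ Unit) :
    Adds D.gates.length (Set.range fun j x => F x j)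
      (Set.range fun (j : Unit) x => D.eval (F x) j) := by
  have h := (Adds.gates F D.gates).trans (s' := 0)
    (V := Set.range fun (j : Unit) x => D.eval (F x) j) ?_
  · simpa using h
  · have hw := Adds.wire (F := F) (Γ := D.gates)
      (T := {f | ∃ k < D.gates.length, f = fun x => (gateValues (F x) D.gates).getD k false})
      (fun k => (lt_or_ge k D.gates.length).imp_left fun h => ⟨k, h, rfl⟩) (D.output ())
    rw [Set.union_comm]
    have e : (Set.range fun (j : Unit) x => D.eval (F x) j) =
        {fun x => (D.output ()).value (F x) (gateValues (F x) D.gates)} := by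
      rw [Set.range_unique]
      rfl
    rw [e]
    exact hw

/-- Precomposition of a distinguisher with a function that has small circuits. -/
theorem exists_comp_circuit {ι κ : Type} {s : ℕ} {F : (ι → Bool) → κ → Bool}
    (H : Adds s ∅ (Set.range fun j x => F x j)) (D : Circuit κ Unit) :
    ∃ D' : Circuit ι Unit, D'.size ≤ s + D.size ∧ ∀ x, D'.eval x = D.eval (F x) := by
  obtain ⟨D', h1, h2⟩ := exists_circuit (F := fun x => D.eval (F x))
    (H.trans ((Adds.circuit F D).mono le_rfl (Set.subset_union_right)))
  refine ⟨D', ?_, h2⟩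
  simp only [Circuit.size]
  omega

/-! ### Modular arithmetic -/

section Arithmetic

variable {ι : Type} {T : Set ((ι → Bool) → Bool)} {K : ℕ} {Y : (ι → Bool) → ℕ}

/-- Comparison with a constant, from the top bit down: if `c ≤ 2 ^ j`, a set top bit suffices on its
own; otherwise it is necessary and `2 ^ j` is subtracted from `c`. Each bit costs one OR or one AND,
hence at most three gates. -/
theorem Adds.le_mod (hT : ∀ j < K, (fun x => (Y x).testBit j) ∈ T) {j : ℕ} (hj : j ≤ K) (c : ℕ) :
    Adds (3 * j) T {fun x => decide (c ≤ Y x % 2 ^ j)} := by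
  induction j generalizing c with
  | zero =>
    simp only [pow_zero, Nat.mod_one]
    exact Adds.const _
  | succ j ih =>
    have hb := Adds.of_mem (hT j hj)
    have hm : ∀ x, Y x % 2 ^ (j + 1) = Y x % 2 ^ j + if (Y x).testBit j then 2 ^ j else 0 := by
      intro x
      rw [Nat.mod_pow_succ, Nat.testBit_eq_decide_div_mod_eq]
      rcases Nat.mod_two_eq_zero_or_one (Y x / 2 ^ j) with h | h <;> simp [h]
    have hlt : ∀ x, Y x % 2 ^ j < 2 ^ j := fun x => Nat.mod_lt _ (by positivity)
    by_cases hc : c ≤ 2 ^ j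
    · have e : (fun x => decide (c ≤ Y x % 2 ^ (j + 1))) =
          fun x => (Y x).testBit j || decide (c ≤ Y x % 2 ^ j) := by
        funext x
        rw [hm]
        cases (Y x).testBit j
        · simp
        · simp; omega
      rw [e]
      exact (hb.or (ih (by omega) c)).mono (by omega) subset_rfl
    · have e : (fun x => decide (c ≤ Y x % 2 ^ (j + 1))) =
          fun x => (Y x).testBit j && decide (c - 2 ^ j ≤ Y x % 2 ^ j) := by
        funext x
        have := hlt x
        rw [hm]
        cases (Y x).testBit j
        · simp; omega
        · simp
      rw [e]
      exact (hb.and (ih (by omega) _)).mono (by omega) subset_rfl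

/-- The carry into position `j` is a comparison of the lower parts. When `b` is a constant this is a
threshold test on `a`, so no chain of carries has to be built. -/
theorem testBit_add_carry (a b j : ℕ) :
    (a + b).testBit j =
      ((a.testBit j ^^ b.testBit j) ^^ decide (2 ^ j - b % 2 ^ j ≤ a % 2 ^ j)) := by
  have hp : 0 < 2 ^ j := by positivity
  have hc : (a + b) / 2 ^ j =
      a / 2 ^ j + b / 2 ^ j + if 2 ^ j - b % 2 ^ j ≤ a % 2 ^ j then 1 else 0 := by
    rw [Nat.add_div hp]
    congr 1
    exact if_congr (by omega) rfl rfl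
  simp only [Nat.testBit_eq_decide_div_mod_eq, hc]
  rcases Nat.mod_two_eq_zero_or_one (a / 2 ^ j) with h | h <;>
  rcases Nat.mod_two_eq_zero_or_one (b / 2 ^ j) with h' | h' <;>
  split_ifs with h'' <;> simp [Nat.add_mod, h, h', h'']

theorem Adds.add_const (hT : ∀ j < K, (fun x => (Y x).testBit j) ∈ T) {j : ℕ} (hj : j < K)
    (c : ℕ) : Adds (6 * K + 7) T {fun x => (Y x + c).testBit j} := by
  have hb := Adds.of_mem (hT j hj)
  have hbc : Adds 1 T {fun x => (Y x).testBit j ^^ c.testBit j} := by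
    cases c.testBit j
    · simpa using hb.mono (Nat.zero_le 1) subset_rfl
    · simpa using hb.not
  simp only [testBit_add_carry]
  exact (hbc.xor (Adds.le_mod hT hj.le _)).mono (by omega) subset_rfl

theorem Adds.add_mod {q : ℕ} [NeZero q] {Y : (ι → Bool) → ZMod q}
    (hT : ∀ j < Nat.clog 2 q, (fun x => (Y x).val.testBit j) ∈ T) (i : ι) (a : ZMod q) {j : ℕ}
    (hj : j < Nat.clog 2 q) :
    Adds (18 * Nat.clog 2 q + 22) T
      {fun x => (Y x + if x i then a else 0).val.testBit j} := by
  set K := Nat.clog 2 q with hK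
  have hqK : q ≤ 2 ^ K := Nat.le_pow_clog (by norm_num) q
  have ha := ZMod.val_lt a
  have hle := Adds.le_mod (Y := fun x => (Y x).val) hT le_rfl (q - a.val)
  -- On overflow `q` must be subtracted. Adding `2 ^ K - q` instead gives the same result up to a
  -- summand `2 ^ K`, which does not affect the bits below position `K`.
  have h1 := Adds.add_const (Y := fun x => (Y x).val) hT hj (a.val + (2 ^ K - q))
  have h2 := Adds.add_const (Y := fun x => (Y x).val) hT hj a.val
  have h := (Adds.input (T := T) i).mux (hle.mux h1 h2) (Adds.of_mem (hT j hj))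
  refine Adds.mono (by omega) subset_rfl (T := T) (s := 2 * 0 +
    (2 * (3 * K) + (6 * K + 7) + (6 * K + 7) + 4) + 0 + 4) ?_
  convert h using 2
  funext x
  have hY := ZMod.val_lt (Y x)
  cases x i
  · simp
  · simp only [if_true]
    rw [Nat.mod_eq_of_lt (hY.trans_le hqK)]
    by_cases hc : q - a.val ≤ (Y x).val
    · rw [if_pos (by simpa using hc), ZMod.val_add_of_le (by omega)]
      have e : (Y x).val + (a.val + (2 ^ K - q)) = 2 ^ K + ((Y x).val + a.val - q) := by omega
      rw [e, Nat.testBit_two_pow_add_gt hj]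
    · rw [if_neg (by simpa using hc), ZMod.val_add_of_lt (by omega)]

/-- An affine form modulo `q` in the input bits. -/
def affineForm {q : ℕ} (c : ZMod q) (l : List (ι × ZMod q)) (x : ι → Bool) : ZMod q :=
  c + (l.map fun y => if x y.1 then y.2 else 0).sum

/-- The number of gates that add a constant modulo `q`, controlled by a bit. -/
def modCost (q : ℕ) : ℕ := Nat.clog 2 q * (18 * Nat.clog 2 q + 22)

theorem Adds.affine_all {q : ℕ} [NeZero q] (c : ZMod q) (l : List (ι × ZMod q)) :
    Adds (l.length * modCost q) (∅ : Set ((ι → Bool) → Bool))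
      (Set.range fun (j : Fin (Nat.clog 2 q)) x => (affineForm c l x).val.testBit j) := by
  induction l using List.reverseRecOn with
  | nil =>
    simp only [affineForm, List.map_nil, List.sum_nil, List.length_nil, Nat.zero_mul]
    simpa using Adds.range (s := 0) (T := (∅ : Set ((ι → Bool) → Bool)))
      (F := fun (j : Fin (Nat.clog 2 q)) _ => (c + 0).val.testBit j) fun j => Adds.const _
  | append_singleton l y ih =>
    have e : ∀ x, affineForm c (l ++ [y]) x = affineForm c l x + if x y.1 then y.2 else 0 := by
      intro x
      simp [affineForm, add_assoc]
    simp only [e, List.length_append, List.length_singleton, Nat.succ_mul]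
    refine ih.trans ?_
    have := Adds.range (s := 18 * Nat.clog 2 q + 22)
      (T := (∅ : Set ((ι → Bool) → Bool)) ∪ Set.range fun (j : Fin (Nat.clog 2 q)) x =>
        (affineForm c l x).val.testBit j)
      (F := fun (j : Fin (Nat.clog 2 q)) x =>
        (affineForm c l x + if x y.1 then y.2 else 0).val.testBit j) fun j =>
      Adds.add_mod (fun j hj => Or.inr ⟨⟨j, hj⟩, rfl⟩) y.1 y.2 j.2
    simpa [modCost] using this

theorem Adds.affine {q : ℕ} [NeZero q] (c : ZMod q) (l : List (ι × ZMod q))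
    (j : Fin (Nat.clog 2 q)) :
    Adds (l.length * modCost q) (∅ : Set ((ι → Bool) → Bool))
      {fun x => (affineForm c l x).val.testBit j} := fun L hL hT =>
  let ⟨L', h1, h2, h3⟩ := Adds.affine_all c l L hL hT
  ⟨L', h1, h2, Set.singleton_subset_iff.2 (h3 ⟨j, rfl⟩)⟩

end Arithmetic

/-- The binary expansion of a residue. -/
theorem sum_testBit {q : ℕ} [NeZero q] (x : ZMod q) :
    ∑ b : Fin (Nat.clog 2 q), (if x.val.testBit b then (2 : ZMod q) ^ (b : ℕ) else 0) = x := by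
  have key : ∀ K m : ℕ, ∑ b : Fin K, (if m.testBit b then 2 ^ (b : ℕ) else 0) = m % 2 ^ K := by
    intro K m
    induction K with
    | zero => simp [Nat.mod_one]
    | succ K ih =>
      rw [Fin.sum_univ_castSucc]
      simp only [Fin.val_castSucc, Fin.val_last, ih]
      rw [Nat.mod_pow_succ, Nat.testBit_eq_decide_div_mod_eq]
      rcases Nat.mod_two_eq_zero_or_one (m / 2 ^ K) with h | h <;> simp [h]
  have h := key (Nat.clog 2 q) x.val
  rw [Nat.mod_eq_of_lt ((ZMod.val_lt x).trans_le (Nat.le_pow_clog (by norm_num) q))] at h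
  have h' := congrArg (fun m : ℕ => (m : ZMod q)) h
  simpa using h'

/-! ### Independent columns and blocks -/

theorem bind_congr {α β : Type} {P : PMF α} {f g : α → PMF β} (h : ∀ a, f a = g a) :
    P.bind f = P.bind g := congrArg _ (funext h)

theorem bind_comm₃ {α₁ α₂ α₃ β γ : Type} (p₁ : PMF α₁) (p₂ : PMF α₂) (p₃ : PMF α₃) (q : PMF β)
    (f : α₁ → α₂ → α₃ → β → PMF γ) :
    (p₁.bind fun a₁ => p₂.bind fun a₂ => p₃.bind fun a₃ => q.bind fun b => f a₁ a₂ a₃ b) =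
      q.bind fun b => p₁.bind fun a₁ => p₂.bind fun a₂ => p₃.bind fun a₃ => f a₁ a₂ a₃ b := by
  simp only [PMF.bind_comm _ q]

theorem bind_comm₄ {α₁ α₂ α₃ α₄ β γ : Type} (p₁ : PMF α₁) (p₂ : PMF α₂) (p₃ : PMF α₃)
    (p₄ : PMF α₄) (q : PMF β) (f : α₁ → α₂ → α₃ → α₄ → β → PMF γ) :
    (p₁.bind fun a₁ => p₂.bind fun a₂ => p₃.bind fun a₃ => p₄.bind fun a₄ => q.bind fun b =>
        f a₁ a₂ a₃ a₄ b) =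
      q.bind fun b => p₁.bind fun a₁ => p₂.bind fun a₂ => p₃.bind fun a₃ => p₄.bind fun a₄ =>
        f a₁ a₂ a₃ a₄ b := by
  rw [PMF.bind_comm q p₁]
  exact bind_congr fun a₁ => bind_comm₃ _ _ _ _ _

/-- Used both to split the LWE matrix into `(A | B)` by rows and to split the error vectors into the
columns of `E` and `E'`. -/
theorem iid_append_bind {m a b : ℕ} {α β : Type} [Fintype α] (μ : PMF α)
    (f : (Fin m → Fin (a + b) → α) → PMF β) :
    (iid (Fin m) (iid (Fin (a + b)) μ)).bind f =
      (iid (Fin m) (iid (Fin a) μ)).bind fun x => (iid (Fin m) (iid (Fin b) μ)).bind fun y =>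
        f fun j => Fin.append (x j) (y j) := by
  rw [← prodPMF_bind (f := fun z : (Fin m → Fin a → α) × (Fin m → Fin b → α) =>
    f fun j => Fin.append (z.1 j) (z.2 j))]
  symm
  refine bind_equiv (e := ((Equiv.arrowProdEquivProdArrow (Fin m) _ _).symm.trans
    (Equiv.arrowCongr (Equiv.refl _) (Fin.appendEquiv a b)))) ?_ f
  rintro ⟨x, y⟩
  rw [prodPMF_apply, iid_apply, iid_apply, iid_apply, ← Finset.prod_mul_distrib]
  refine Finset.prod_congr rfl fun j _ => ?_
  rw [iid_apply, iid_apply, iid_apply, Fin.prod_univ_add]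
  simp [Fin.appendEquiv]

theorem iid_prod_bind {ι : Type} [Fintype ι] [DecidableEq ι] {α β γ : Type} [Fintype α] [Fintype β]
    (μ : PMF α) (ν : PMF β) (f : (ι → α × β) → PMF γ) :
    (iid ι (prodPMF μ ν)).bind f =
      (iid ι μ).bind fun x => (iid ι ν).bind fun y => f fun j => (x j, y j) := by
  rw [← prodPMF_bind (f := fun z : (ι → α) × (ι → β) => f fun j => (z.1 j, z.2 j))]
  symm
  refine bind_equiv (e := (Equiv.arrowProdEquivProdArrow ι _ _).symm) ?_ f
  rintro ⟨x, y⟩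
  rw [prodPMF_apply, iid_apply, iid_apply, iid_apply, ← Finset.prod_mul_distrib]
  exact Finset.prod_congr rfl fun j _ => (prodPMF_apply μ ν (x j, y j)).symm

theorem uniformMatrix_bind_rows {a b q : ℕ} [NeZero q] {β : Type}
    (f : Matrix (Fin a) (Fin b) (ZMod q) → PMF β) :
    (uniformMatrix a b q).bind f =
      (iid (Fin a) (iid (Fin b) (PMF.uniformOfFintype (ZMod q)))).bind fun x =>
        f (Matrix.of x) := by
  rw [iid_uniform, iid_uniform]
  exact (uniform_bind_equiv (Matrix.of : (Fin a → Fin b → ZMod q) ≃ _) f).symm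

theorem uniformMatrix_bind_cols {a b q : ℕ} [NeZero q] {β : Type}
    (f : Matrix (Fin a) (Fin b) (ZMod q) → PMF β) :
    (uniformMatrix a b q).bind f =
      (iid (Fin b) (iid (Fin a) (PMF.uniformOfFintype (ZMod q)))).bind fun x =>
        f (colEquiv a b _ x) := by
  rw [iid_uniform, iid_uniform]
  exact (uniform_bind_equiv (colEquiv a b (ZMod q)) f).symm

theorem uniformMatrix_append_bind {m a b q : ℕ} [NeZero q] {β : Type}
    (f : Matrix (Fin m) (Fin (a + b)) (ZMod q) → PMF β) :
    (uniformMatrix m (a + b) q).bind f =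
      (uniformMatrix m a q).bind fun A => (uniformMatrix m b q).bind fun B =>
        f (Matrix.of fun i => Fin.append (A i) (B i)) := by
  simp only [uniformMatrix_bind_rows, iid_append_bind]
  rfl

theorem gaussMatrix_bind_cols {a b q : ℕ} [NeZero q] {σ : ℝ} (hσ : 0 < σ) {β : Type}
    (f : Matrix (Fin a) (Fin b) (ZMod q) → PMF β) :
    (gaussMatrix a b q σ hσ).bind f =
      (iid (Fin b) (iid (Fin a) (gaussMod q σ hσ))).bind fun x => f (colEquiv a b _ x) := by
  have h1 : gaussMatrix a b q σ hσ =
      (iid (Fin a × Fin b) (gaussMod q σ hσ)).map fun x => Matrix.of fun i j => x (i, j) := by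
    rw [← discreteGaussian_map_cast, PMF.map_comp]
    rfl
  rw [h1, PMF.bind_map]
  refine bind_equiv (e := ((Equiv.prodComm (Fin b) (Fin a)).arrowCongr (Equiv.refl _)).symm.trans
    (Equiv.curry (Fin b) (Fin a) (ZMod q))) ?_ fun x => f (colEquiv a b _ x)
  intro x
  simp only [iid_apply]
  rw [Fintype.prod_prod_type, Finset.prod_comm]
  rfl

theorem discreteGaussian_bind_cast {ι : Type} [Fintype ι] [DecidableEq ι] {q : ℕ} [NeZero q] {σ : ℝ}
    (hσ : 0 < σ) {β : Type} (f : (ι → ZMod q) → PMF β) :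
    ((discreteGaussian ι σ hσ).bind fun x => f fun i => (x i : ZMod q)) =
      (iid ι (gaussMod q σ hσ)).bind f := by
  rw [← discreteGaussian_map_cast, PMF.bind_map]
  rfl

/-! ### The view of a party -/

theorem uniformMatrix_bind_sub {a b q : ℕ} [NeZero q] {β : Type}
    (M : Matrix (Fin a) (Fin b) (ZMod q)) (f : Matrix (Fin a) (Fin b) (ZMod q) → PMF β) :
    (uniformMatrix a b q).bind f = (uniformMatrix a b q).bind fun U => f (M - U) :=
  (uniform_bind_equiv (Equiv.subLeft M) f).symm

theorem uniformMatrix_bind_add {a b q : ℕ} [NeZero q] {β : Type}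
    (M : Matrix (Fin a) (Fin b) (ZMod q)) (f : Matrix (Fin a) (Fin b) (ZMod q) → PMF β) :
    ((uniformMatrix a b q).bind fun U => f (M + U)) = (uniformMatrix a b q).bind f :=
  uniform_bind_equiv (Equiv.addLeft M) f

/-- The view of either party, in terms of its own uniform shares `U` and `V` and of the coins `R'`
of the other party. -/
theorem viewDist_eq (i : Fin 2) (p : Params)
    (X : Matrix (Fin p.d₁) (Fin p.d₂) (fixedPoint p.k p.l))
    (Y : Matrix (Fin p.d₂) (Fin p.d₃) (fixedPoint p.k p.l)) :
    viewDist i p X Y =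
      (uniformMatrix p.n p.d₁ p.q).bind fun U => (uniformMatrix p.d₂ p.d₃ p.q).bind fun V =>
      (uniformMatrix p.t p.d₃ 3).bind fun R => (uniformMatrix p.n p.d₂ p.q).bind fun A =>
      (gaussMatrix p.n p.d₁ p.q p.σ p.σ_pos).bind fun S =>
      (gaussMatrix p.d₂ p.d₁ p.q p.σ p.σ_pos).bind fun E =>
      (gaussMatrix p.t p.d₁ p.q p.σ p.σ_pos).bind fun E' =>
      (uniformMatrix p.n p.t p.q).bind fun B => (uniformMatrix p.t p.d₃ 3).bind fun R' =>
      PMF.pure (View.encode {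
        A := A, B := B, C := Aᵀ * S + (encodeFixed p.l p.q X)ᵀ + E, C' := Bᵀ * S + E', S := U
        Y := V, R := R
        H := A * (encodeFixed p.l p.q Y - V) + B * ternary p.q R' : View p }) := by
  set Xb := encodeFixed p.l p.q X with hXb
  set Yb := encodeFixed p.l p.q Y with hYb
  have h1 : viewDist i p X Y =
      (uniformMatrix p.n p.d₂ p.q).bind fun A => (uniformMatrix p.n p.t p.q).bind fun B =>
      (gaussMatrix p.n p.d₁ p.q p.σ p.σ_pos).bind fun S =>
      (gaussMatrix p.d₂ p.d₁ p.q p.σ p.σ_pos).bind fun E =>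
      (gaussMatrix p.t p.d₁ p.q p.σ p.σ_pos).bind fun E' =>
      (uniformMatrix p.n p.d₁ p.q).bind fun U => (uniformMatrix p.d₂ p.d₃ p.q).bind fun V =>
      (uniformMatrix p.t p.d₃ 3).bind fun R =>
      (uniformMatrix p.t p.d₃ 3).bind fun R' =>
      PMF.pure (View.encode {
        A := A, B := B, C := Aᵀ * S + Xbᵀ + E, C' := Bᵀ * S + E', S := U
        Y := V, R := R
        H := A * (Yb - V) + B * ternary p.q R' : View p }) := by
    simp only [viewDist, mult, setup, offline, online, share, bind, pure, PMF.map_bind,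
      PMF.bind_bind, PMF.pure_bind, PMF.pure_map, ← hXb, ← hYb]
    refine bind_congr fun A => bind_congr fun B => bind_congr fun S => bind_congr fun E =>
      bind_congr fun E' => ?_
    -- The share of `P₀` is the uniform matrix itself. For `P₁` it is the secret minus a uniform
    -- matrix, so the substitutions `U ↦ S - U` and `V ↦ Yb - V` exchange the roles of the two
    -- shares; the coins of the parties are swapped as well.
    fin_cases i
    · rfl
    · rw [uniformMatrix_bind_sub S]
      refine bind_congr fun U => ?_
      rw [uniformMatrix_bind_sub Yb]
      refine bind_congr fun V => ?_
      rw [PMF.bind_comm]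
      refine bind_congr fun R => bind_congr fun R' => ?_
      simp [Execution.view]
  rw [h1]
  calc _ = (uniformMatrix p.n p.d₂ p.q).bind fun A =>
      (gaussMatrix p.n p.d₁ p.q p.σ p.σ_pos).bind fun S =>
      (gaussMatrix p.d₂ p.d₁ p.q p.σ p.σ_pos).bind fun E =>
      (gaussMatrix p.t p.d₁ p.q p.σ p.σ_pos).bind fun E' =>
      (uniformMatrix p.n p.d₁ p.q).bind fun U => (uniformMatrix p.d₂ p.d₃ p.q).bind fun V =>
      (uniformMatrix p.t p.d₃ 3).bind fun R =>
      (uniformMatrix p.n p.t p.q).bind fun B => (uniformMatrix p.t p.d₃ 3).bind fun R' =>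
      PMF.pure (View.encode {
        A := A, B := B, C := Aᵀ * S + Xbᵀ + E, C' := Bᵀ * S + E', S := U
        Y := V, R := R
        H := A * (Yb - V) + B * ternary p.q R' : View p }) := by
        refine bind_congr fun A => ?_
        rw [← bind_comm₃]
        refine bind_congr fun S => bind_congr fun E => bind_congr fun E' => ?_
        rw [← bind_comm₃]
    _ = _ := by
        rw [bind_comm₄]
        refine bind_congr fun U => ?_
        rw [bind_comm₄]
        refine bind_congr fun V => ?_
        rw [bind_comm₄]

/-- The view of a party, but with a uniform share of `H`. -/
def idealView (p : Params) (X : Matrix (Fin p.d₁) (Fin p.d₂) (ZMod p.q)) :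
    PMF (ViewBits p → Bool) :=
  (uniformMatrix p.n p.d₁ p.q).bind fun U => (uniformMatrix p.d₂ p.d₃ p.q).bind fun V =>
  (uniformMatrix p.t p.d₃ 3).bind fun R => (uniformMatrix p.n p.d₃ p.q).bind fun H =>
  (uniformMatrix p.n p.d₂ p.q).bind fun A => (uniformMatrix p.n p.t p.q).bind fun B =>
  (gaussMatrix p.n p.d₁ p.q p.σ p.σ_pos).bind fun S =>
  (gaussMatrix p.d₂ p.d₁ p.q p.σ p.σ_pos).bind fun E =>
  (gaussMatrix p.t p.d₁ p.q p.σ p.σ_pos).bind fun E' =>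
  PMF.pure (View.encode {
    A := A, B := B, C := Aᵀ * S + Xᵀ + E, C' := Bᵀ * S + E', S := U, Y := V, R := R
    H := H : View p })

/-- Two sampling orders are needed. Here `B` and `H` come last, to match the hashing step; in the
definition `U, V, R, H` come first, so that the LWE reduction can fix them. -/
theorem idealView_eq (p : Params) (X : Matrix (Fin p.d₁) (Fin p.d₂) (ZMod p.q)) :
    idealView p X =
      (uniformMatrix p.n p.d₁ p.q).bind fun U => (uniformMatrix p.d₂ p.d₃ p.q).bind fun V =>
      (uniformMatrix p.t p.d₃ 3).bind fun R => (uniformMatrix p.n p.d₂ p.q).bind fun A =>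
      (gaussMatrix p.n p.d₁ p.q p.σ p.σ_pos).bind fun S =>
      (gaussMatrix p.d₂ p.d₁ p.q p.σ p.σ_pos).bind fun E =>
      (gaussMatrix p.t p.d₁ p.q p.σ p.σ_pos).bind fun E' =>
      (uniformMatrix p.n p.t p.q).bind fun B => (uniformMatrix p.n p.d₃ p.q).bind fun H =>
      PMF.pure (View.encode {
        A := A, B := B, C := Aᵀ * S + Xᵀ + E, C' := Bᵀ * S + E', S := U, Y := V, R := R
        H := H : View p }) := by
  refine bind_congr fun U => bind_congr fun V => bind_congr fun R => ?_
  rw [PMF.bind_comm]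
  refine bind_congr fun A => ?_
  rw [bind_comm₃ _ _ _ (uniformMatrix p.n p.t p.q), PMF.bind_comm]
  refine bind_congr fun B => ?_
  rw [← bind_comm₃]

/-- With all other samples fixed, only `B` and `R'` are random. `C'` depends on `B` but not on `R'`,
so it is part of the test, and the shift `A (Y - V)` is absorbed by the uniform matrix. -/
theorem adv_viewDist_idealView (i : Fin 2) (p : Params)
    (X : Matrix (Fin p.d₁) (Fin p.d₂) (fixedPoint p.k p.l))
    (Y : Matrix (Fin p.d₂) (Fin p.d₃) (fixedPoint p.k p.l))
    (hq : (p.q : ℝ) ^ (2 * p.n) ≤ 2 ^ p.t) {ε : ℝ} (hε : 0 ≤ ε)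
    (h : p.n ≠ 0 → ((p.q : ℝ) ^ p.n)⁻¹ ≤ ε ^ 4) (s : Set (ViewBits p → Bool)) :
    adv s (viewDist i p X Y) (idealView p (encodeFixed p.l p.q X)) ≤ p.d₃ * ε := by
  rw [viewDist_eq, idealView_eq]
  refine adv_bind_le _ fun U => adv_bind_le _ fun V => adv_bind_le _ fun R =>
    adv_bind_le _ fun A => adv_bind_le _ fun S => adv_bind_le _ fun E => adv_bind_le _ fun E' => ?_
  have := leftover_hash_matrix hq hε h p.d₃ (fun B W => PMF.pure (View.encode {
    A := A, B := B, C := Aᵀ * S + (encodeFixed p.l p.q X)ᵀ + E, C' := Bᵀ * S + E', S := U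
    Y := V, R := R, H := A * (encodeFixed p.l p.q Y - V) + W : View p })) s
  have e : ∀ B : Matrix (Fin p.n) (Fin p.t) (ZMod p.q), _ := fun B =>
    uniformMatrix_bind_add (A * (encodeFixed p.l p.q Y - V)) fun W => PMF.pure (View.encode {
      A := A, B := B, C := Aᵀ * S + (encodeFixed p.l p.q X)ᵀ + E, C' := Bᵀ * S + E', S := U
      Y := V, R := R, H := W : View p })
  rwa [bind_congr e] at this

/-! ### The reduction to LWE -/

/-- The view with the common reference string `M = (A | B)` and with the ciphertexts
`C = c + Xᵀ` and `C' = c'`, where `c` and `c'` are the upper and the lower parts of the columns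
`c j`. -/
def assemble (p : Params) (X : Matrix (Fin p.d₁) (Fin p.d₂) (ZMod p.q))
    (U : Matrix (Fin p.n) (Fin p.d₁) (ZMod p.q)) (V : Matrix (Fin p.d₂) (Fin p.d₃) (ZMod p.q))
    (R : Matrix (Fin p.t) (Fin p.d₃) (ZMod 3)) (H : Matrix (Fin p.n) (Fin p.d₃) (ZMod p.q))
    (M : Matrix (Fin p.n) (Fin (p.d₂ + p.t)) (ZMod p.q))
    (c : Fin p.d₁ → Fin (p.d₂ + p.t) → ZMod p.q) : View p where
  A := Matrix.of fun i k => M i (Fin.castAdd p.t k)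
  B := Matrix.of fun i k => M i (Fin.natAdd p.d₂ k)
  C := Matrix.of fun k j => X j k + c j (Fin.castAdd p.t k)
  C' := Matrix.of fun k j => c j (Fin.natAdd p.d₂ k)
  S := U
  Y := V
  R := R
  H := H

/-- The seed of an LWE sample: the secret and the error. -/
def lweSeed (n m q : ℕ) [NeZero q] (σ : ℝ) (hσ : 0 < σ) :
    PMF ((Fin n → ZMod q) × (Fin m → ZMod q)) :=
  prodPMF (iid (Fin n) (gaussMod q σ hσ)) (iid (Fin m) (gaussMod q σ hσ))

/-- The LWE sample computed from a seed. -/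
def lweSample {n m q : ℕ} (M : Matrix (Fin n) (Fin m) (ZMod q))
    (ξ : (Fin n → ZMod q) × (Fin m → ZMod q)) : Fin m → ZMod q :=
  Mᵀ *ᵥ ξ.1 + ξ.2

theorem lweReal_eq (n m q : ℕ) [NeZero q] (σ : ℝ) (hσ : 0 < σ) :
    lweReal n m q σ hσ = (uniformMatrix n m q).bind fun M => (lweSeed n m q σ hσ).bind fun ξ =>
      PMF.pure (Sum.elim (encMat M) (encVec (lweSample M ξ))) := by
  simp only [lweReal, bind, pure, lweSeed, prodPMF_bind, lweSample]
  refine bind_congr fun M => ?_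
  rw [← discreteGaussian_bind_cast]
  refine bind_congr fun s => ?_
  rw [← discreteGaussian_bind_cast]

/-- Column `j` of `C - Xᵀ` on top of column `j` of `C'` equals `(A | B)ᵀ s + e`, where `s` is column
`j` of `S` and `e` stacks those of `E` and `E'`. The columns thus form LWE samples with one common
matrix and independent seeds. -/
theorem idealView_assemble (p : Params) (X : Matrix (Fin p.d₁) (Fin p.d₂) (ZMod p.q)) :
    idealView p X =
      (uniformMatrix p.n p.d₁ p.q).bind fun U => (uniformMatrix p.d₂ p.d₃ p.q).bind fun V =>
      (uniformMatrix p.t p.d₃ 3).bind fun R => (uniformMatrix p.n p.d₃ p.q).bind fun H =>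
      (uniformMatrix p.n (p.d₂ + p.t) p.q).bind fun M =>
      (iid (Fin p.d₁) (lweSeed p.n (p.d₂ + p.t) p.q p.σ p.σ_pos)).bind fun ξ =>
      PMF.pure (assemble p X U V R H M fun j => lweSample M (ξ j)).encode := by
  refine bind_congr fun U => bind_congr fun V => bind_congr fun R => bind_congr fun H => ?_
  rw [uniformMatrix_append_bind]
  refine bind_congr fun A => bind_congr fun B => ?_
  rw [lweSeed, iid_prod_bind, gaussMatrix_bind_cols]
  refine bind_congr fun S => ?_
  rw [iid_append_bind, gaussMatrix_bind_cols]
  refine bind_congr fun E => ?_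
  rw [gaussMatrix_bind_cols]
  refine bind_congr fun E' => ?_
  congr 2
  simp only [assemble, View.mk.injEq, and_true]
  refine ⟨?_, ?_, ?_, ?_⟩
  · ext i k
    simp
  · ext i k
    simp
  · ext k j
    simp [lweSample, Matrix.mul_apply, Matrix.mulVec, dotProduct]
    ring
  · ext k j
    simp [lweSample, Matrix.mul_apply, Matrix.mulVec, dotProduct]

/-- This is where `X` disappears: the left side does not mention it, since translation by `Xᵀ`
preserves the uniform distribution of `C`. -/
theorem uniformView_assemble (p : Params) (X : Matrix (Fin p.d₁) (Fin p.d₂) (ZMod p.q)) :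
    uniformView p =
      (uniformMatrix p.n p.d₁ p.q).bind fun U => (uniformMatrix p.d₂ p.d₃ p.q).bind fun V =>
      (uniformMatrix p.t p.d₃ 3).bind fun R => (uniformMatrix p.n p.d₃ p.q).bind fun H =>
      (uniformMatrix p.n (p.d₂ + p.t) p.q).bind fun M =>
      (iid (Fin p.d₁) (uniformVec (p.d₂ + p.t) p.q)).bind fun ξ =>
      PMF.pure (assemble p X U V R H M ξ).encode := by
  simp only [uniformView, bind, pure]
  rw [bind_comm₄]
  refine bind_congr fun U => ?_
  rw [bind_comm₄]
  refine bind_congr fun V => ?_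
  rw [bind_comm₄]
  refine bind_congr fun R => ?_
  rw [bind_comm₄]
  refine bind_congr fun H => ?_
  rw [uniformMatrix_append_bind]
  refine bind_congr fun A => bind_congr fun B => ?_
  rw [uniformVec, ← iid_uniform, iid_append_bind, ← uniformMatrix_bind_add Xᵀ,
    uniformMatrix_bind_cols]
  refine bind_congr fun C => ?_
  rw [uniformMatrix_bind_cols]
  refine bind_congr fun C' => ?_
  congr 2
  simp only [assemble, View.mk.injEq, and_true]
  refine ⟨?_, ?_, ?_, ?_⟩
  · ext i k
    simp
  · ext i k
    simp
  · ext k j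
    simp
  · ext k j
    simp

/-- The affine form, in the bits of an LWE instance `(M, b)`, of entry `k` of column `i` in a hybrid
distribution: a fixed column to the left of the challenge column `j`, the challenge `b`, and a
column with a fixed seed to its right. -/
def hybridForm {n m q d : ℕ} (j : Fin d) (ξ₁ : Fin d → (Fin n → ZMod q) × (Fin m → ZMod q))
    (ξ₂ : Fin d → Fin m → ZMod q) (i : Fin d) (k : Fin m) :
    ZMod q × List (LWEBits n m q × ZMod q) :=
  if i = j then
    (0, (Finset.univ : Finset (Fin (Nat.clog 2 q))).toList.map fun b =>
      (Sum.inr (k, b), 2 ^ (b : ℕ)))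
  else if i < j then (ξ₂ i k, [])
  else ((ξ₁ i).2 k, (Finset.univ : Finset (Fin n × Fin (Nat.clog 2 q))).toList.map fun z =>
      (Sum.inl (z.1, k, z.2), (ξ₁ i).1 z.1 * 2 ^ (z.2 : ℕ)))

theorem length_hybridForm_le {n m q d : ℕ} (j : Fin d)
    (ξ₁ : Fin d → (Fin n → ZMod q) × (Fin m → ZMod q))
    (ξ₂ : Fin d → Fin m → ZMod q) (i : Fin d) (k : Fin m) :
    (hybridForm j ξ₁ ξ₂ i k).2.length ≤ (n + 1) * Nat.clog 2 q := by
  unfold hybridForm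
  split_ifs
  · simp [Nat.succ_mul]
  · simp
  · simp [Nat.succ_mul]

/-- With the seeds fixed, `Mᵀ s + e` is affine in the entries of `M`, and each entry is a linear
combination of its bits by `sum_testBit`. The same expansion handles the challenge column. -/
theorem affineForm_hybridForm {n m q d : ℕ} [NeZero q] (j : Fin d)
    (ξ₁ : Fin d → (Fin n → ZMod q) × (Fin m → ZMod q))
    (ξ₂ : Fin d → Fin m → ZMod q) (i : Fin d) (k : Fin m) (c : ZMod q)
    (M : Matrix (Fin n) (Fin m) (ZMod q)) (b : Fin m → ZMod q) :
    affineForm (c + (hybridForm j ξ₁ ξ₂ i k).1) (hybridForm j ξ₁ ξ₂ i k).2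
      (Sum.elim (encMat M) (encVec b)) =
    c + Function.update (fun i => if i < j then ξ₂ i else lweSample M (ξ₁ i)) j b i k := by
  unfold hybridForm affineForm
  by_cases hij : i = j
  · subst hij
    simp only [if_true, List.map_map, Function.update_self, add_zero]
    congr 1
    rw [← sum_testBit (b k), ← Finset.sum_map_toList]
    rfl
  · rw [if_neg hij, Function.update_of_ne hij]
    by_cases hlt : i < j
    · simp [hlt]
    · simp only [hlt, if_false, List.map_map, add_assoc]
      congr 1
      rw [lweSample, Pi.add_apply, add_comm]
      congr 1
      have : (Mᵀ *ᵥ (ξ₁ i).1) k = ∑ a : Fin n, ∑ z : Fin (Nat.clog 2 q),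
          if (M a k).val.testBit z then (ξ₁ i).1 a * 2 ^ (z : ℕ) else 0 := by
        simp only [Matrix.mulVec, dotProduct, Matrix.transpose_apply]
        refine Finset.sum_congr rfl fun a _ => ?_
        conv_lhs => rw [mul_comm, ← sum_testBit (M a k), Finset.mul_sum]
        simp
      rw [this, ← Fintype.sum_prod_type', ← Finset.sum_map_toList]
      rfl

/-- The map on bit strings of the reduction. -/
def reduction (p : Params) (X : Matrix (Fin p.d₁) (Fin p.d₂) (ZMod p.q))
    (U : Matrix (Fin p.n) (Fin p.d₁) (ZMod p.q)) (V : Matrix (Fin p.d₂) (Fin p.d₃) (ZMod p.q))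
    (R : Matrix (Fin p.t) (Fin p.d₃) (ZMod 3)) (H : Matrix (Fin p.n) (Fin p.d₃) (ZMod p.q))
    (f : Fin p.d₁ → Fin (p.d₂ + p.t) →
      ZMod p.q × List (LWEBits p.n (p.d₂ + p.t) p.q × ZMod p.q))
    (x : LWEBits p.n (p.d₂ + p.t) p.q → Bool) : ViewBits p → Bool :=
  Sum.elim (fun z => x (Sum.inl (z.1, Fin.castAdd p.t z.2.1, z.2.2))) <|
    Sum.elim (fun z => x (Sum.inl (z.1, Fin.natAdd p.d₂ z.2.1, z.2.2))) <|
    Sum.elim (encMat (Matrix.of fun k j => affineForm (X j k + (f j (Fin.castAdd p.t k)).1)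
      (f j (Fin.castAdd p.t k)).2 x)) <|
    Sum.elim (encMat (Matrix.of fun k j => affineForm (0 + (f j (Fin.natAdd p.d₂ k)).1)
      (f j (Fin.natAdd p.d₂ k)).2 x)) <|
    Sum.elim (encMat U) <| Sum.elim (encMat V) <| Sum.elim (encMat R) (encMat H)

theorem reduction_encode (p : Params) (X : Matrix (Fin p.d₁) (Fin p.d₂) (ZMod p.q))
    (U : Matrix (Fin p.n) (Fin p.d₁) (ZMod p.q)) (V : Matrix (Fin p.d₂) (Fin p.d₃) (ZMod p.q))
    (R : Matrix (Fin p.t) (Fin p.d₃) (ZMod 3)) (H : Matrix (Fin p.n) (Fin p.d₃) (ZMod p.q))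
    (j : Fin p.d₁) (ξ₁ : Fin p.d₁ → (Fin p.n → ZMod p.q) × (Fin (p.d₂ + p.t) → ZMod p.q))
    (ξ₂ : Fin p.d₁ → Fin (p.d₂ + p.t) → ZMod p.q)
    (M : Matrix (Fin p.n) (Fin (p.d₂ + p.t)) (ZMod p.q)) (b : Fin (p.d₂ + p.t) → ZMod p.q) :
    reduction p X U V R H (hybridForm j ξ₁ ξ₂) (Sum.elim (encMat M) (encVec b)) =
      (assemble p X U V R H M (Function.update
        (fun i => if i < j then ξ₂ i else lweSample M (ξ₁ i)) j b)).encode := by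
  simp only [reduction, affineForm_hybridForm, View.encode, assemble]
  simp only [zero_add]
  rfl

theorem adds_reduction (p : Params) (X : Matrix (Fin p.d₁) (Fin p.d₂) (ZMod p.q))
    (U : Matrix (Fin p.n) (Fin p.d₁) (ZMod p.q)) (V : Matrix (Fin p.d₂) (Fin p.d₃) (ZMod p.q))
    (R : Matrix (Fin p.t) (Fin p.d₃) (ZMod 3)) (H : Matrix (Fin p.n) (Fin p.d₃) (ZMod p.q))
    (f : Fin p.d₁ → Fin (p.d₂ + p.t) →
      ZMod p.q × List (LWEBits p.n (p.d₂ + p.t) p.q × ZMod p.q)) {r : ℕ}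
    (hf : ∀ j k, (f j k).2.length ≤ r) :
    Adds (Fintype.card (ViewBits p) * (r * modCost p.q)) ∅
      (Set.range fun z x => reduction p X U V R H f x z) := by
  refine Adds.range fun z => ?_
  rcases z with z | z | z | z | z | z | z | z
  · exact (Adds.input _).mono (Nat.zero_le _) subset_rfl
  · exact (Adds.input _).mono (Nat.zero_le _) subset_rfl
  · exact (Adds.affine _ _ z.2.2).mono (Nat.mul_le_mul_right _ (hf _ _)) subset_rfl
  · exact (Adds.affine _ _ z.2.2).mono (Nat.mul_le_mul_right _ (hf _ _)) subset_rfl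
  all_goals exact (Adds.const _).mono (Nat.zero_le _) subset_rfl

/-- `D'` places its LWE instance in the critical column of the hybrid argument, completes the view
from fixed data, and runs `D`. -/
theorem exists_lwe_distinguisher (p : Params) (X : Matrix (Fin p.d₁) (Fin p.d₂) (ZMod p.q))
    (D : Circuit (ViewBits p) Unit) :
    ∃ D' : Circuit (LWEBits p.n (p.d₂ + p.t) p.q) Unit,
      D'.size ≤ Fintype.card (ViewBits p) * ((p.n + 1) * Nat.clog 2 p.q * modCost p.q) + D.size ∧
      |acceptProb D (idealView p X) - acceptProb D (uniformView p)| ≤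
        p.d₁ * |acceptProb D' (lweReal p.n (p.d₂ + p.t) p.q p.σ p.σ_pos) -
          acceptProb D' (lweUniform p.n (p.d₂ + p.t) p.q)| := by
  set s : Set (ViewBits p → Bool) := {x | D.eval x () = true} with hs
  change ∃ D' : Circuit (LWEBits p.n (p.d₂ + p.t) p.q) Unit, _ ∧
    adv s (idealView p X) (uniformView p) ≤ _
  rw [idealView_assemble, uniformView_assemble p X]
  refine exists_and_adv_bind_le fun U => exists_and_adv_bind_le fun V =>
    exists_and_adv_bind_le fun R => exists_and_adv_bind_le fun H => ?_
  rcases Nat.eq_zero_or_pos p.d₁ with hd | hd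
  -- Without columns the two distributions coincide and any circuit serves; the one without gates is
  -- no larger than `D`.
  · refine ⟨⟨[], fun _ => .const false⟩, ?_, ?_⟩
    · simp only [Circuit.size, List.length_nil]
      omega
    · have : IsEmpty (Fin p.d₁) := by rw [hd]; infer_instance
      have e : ∀ M ξ, PMF.pure (assemble p X U V R H M ξ).encode =
          PMF.pure (assemble p X U V R H M isEmptyElim).encode := fun M ξ => by
        rw [Subsingleton.elim ξ isEmptyElim]
      simp only [e _ _, PMF.bind_const, adv_self]
      positivity
  · obtain ⟨j, ξ₁, ξ₂, h⟩ := hybrid hd (uniformMatrix p.n (p.d₂ + p.t) p.q)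
      (lweSeed p.n (p.d₂ + p.t) p.q p.σ p.σ_pos) (uniformVec (p.d₂ + p.t) p.q)
      lweSample (fun _ w => w) (fun M c => PMF.pure (assemble p X U V R H M c).encode) s
    obtain ⟨D', hD', he⟩ := exists_comp_circuit (adds_reduction p X U V R H
      (hybridForm j ξ₁ ξ₂) (length_hybridForm_le j ξ₁ ξ₂)) D
    refine ⟨D', hD', h.trans_eq ?_⟩
    have hacc : ∀ P, acceptProb D' P =
        prob s (P.map (reduction p X U V R H (hybridForm j ξ₁ ξ₂))) := by
      intro P
      rw [prob_map, acceptProb, prob]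
      simp only [he]
      rfl
    rw [hacc, hacc, ← adv, lweReal_eq, lweUniform]
    simp only [bind, pure, PMF.map_bind, PMF.pure_map, reduction_encode]

/-! ### Sampling uniform residues with fair coins -/

/-- The residue of the number with the given binary digits. -/
def bitsMod (q : ℕ) {M : ℕ} (x : Fin M → Bool) : ZMod q :=
  ∑ b : Fin M, if x b then (2 : ZMod q) ^ (b : ℕ) else 0

theorem sum_bitsMod {q M : ℕ} (h : ZMod q → ℝ) :
    ∑ x : Fin M → Bool, h (bitsMod q x) = ∑ m ∈ Finset.range (2 ^ M), h m := by
  rw [Finset.sum_range fun m => h (m : ZMod q),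
    ← Equiv.sum_comp ((Equiv.arrowCongr (Equiv.refl (Fin M)) finTwoEquiv.symm).trans
      finFunctionFinEquiv)]
  refine Finset.sum_congr rfl fun x _ => congrArg h ?_
  rw [bitsMod, Equiv.trans_apply, finFunctionFinEquiv_apply, Nat.cast_sum]
  refine Finset.sum_congr rfl fun b _ => ?_
  cases hb : x b <;> simp [hb, finTwoEquiv]

theorem sum_range_residues {q : ℕ} [NeZero q] (h : ZMod q → ℝ) (c : ℕ) :
    ∑ m ∈ Finset.range q, h ((c + m : ℕ) : ZMod q) = ∑ z, h z := by
  rw [← Equiv.sum_comp (Equiv.addLeft (c : ZMod q)) h]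
  refine Finset.sum_nbij' (fun m => (m : ZMod q)) ZMod.val (by simp)
    (fun z _ => Finset.mem_range.2 (ZMod.val_lt z))
    (fun m hm => ZMod.val_cast_of_lt (Finset.mem_range.1 hm)) (by simp) (by simp)

theorem sum_range_mul_residues {q : ℕ} [NeZero q] (h : ZMod q → ℝ) (a : ℕ) :
    ∑ m ∈ Finset.range (q * a), h m = a * ∑ z, h z := by
  induction a with
  | zero => simp
  | succ a ih =>
    rw [Nat.mul_succ, Finset.sum_range_add, ih, sum_range_residues]
    push_cast
    ring

/-- The numbers below `2 ^ M` consist of `a` full periods modulo `q`, which are exactly uniform, and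
`r < q` leftover numbers. Only these contribute to the distance, by at most `r / 2 ^ M`. -/
theorem statClose_bitsMod {q M : ℕ} [NeZero q] {δ : ℝ} (hδ : (q : ℝ) / 2 ^ M ≤ δ) :
    StatClose δ ((PMF.uniformOfFintype (Fin M → Bool)).map (bitsMod q))
      (PMF.uniformOfFintype (ZMod q)) := by
  intro β f s
  set h : ZMod q → ℝ := fun z => prob s (f z) with hh
  have h0 : ∀ z, 0 ≤ h z := fun z => prob_nonneg _ _
  have h1 : ∀ z, h z ≤ 1 := fun z => prob_le_one _ _
  have hq0 : (0 : ℝ) < q := by exact_mod_cast Nat.pos_of_neZero q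
  set S := ∑ z, h z with hS
  have hS0 : 0 ≤ S := Finset.sum_nonneg fun z _ => h0 z
  have hS1 : S ≤ q := by
    refine (Finset.sum_le_sum fun z _ => h1 z).trans ?_
    simp
  set a := 2 ^ M / q
  set r := 2 ^ M % q
  have har : q * a + r = 2 ^ M := Nat.div_add_mod _ _
  set ρ := ∑ m ∈ Finset.range r, h ((q * a + m : ℕ) : ZMod q)
  have hρ0 : 0 ≤ ρ := Finset.sum_nonneg fun z _ => h0 _
  have hρ1 : ρ ≤ r := by
    refine (Finset.sum_le_sum fun z _ => h1 _).trans ?_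
    simp
  have hsum : ∑ x : Fin M → Bool, h (bitsMod q x) = a * S + ρ := by
    rw [sum_bitsMod, ← har, Finset.sum_range_add, sum_range_mul_residues]
  have e1 : prob s (((PMF.uniformOfFintype (Fin M → Bool)).map (bitsMod q)).bind f) =
      (2 ^ M)⁻¹ * (a * S + ρ) := by
    rw [PMF.bind_map, prob_bind, ← hsum, Finset.mul_sum]
    simp [hh]
  have e2 : prob s ((PMF.uniformOfFintype (ZMod q)).bind f) = (q : ℝ)⁻¹ * S := by
    rw [prob_bind, hS, Finset.mul_sum]
    simp [hh]
  have hr : (r : ℝ) ≤ q := by exact_mod_cast (Nat.mod_lt _ (Nat.pos_of_neZero q)).le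
  have hr0 : (0 : ℝ) ≤ r := Nat.cast_nonneg r
  have hT : (q : ℝ) * a + r = 2 ^ M := by exact_mod_cast har
  have hT0 : (0 : ℝ) < 2 ^ M := by positivity
  -- Both `ρ` and `r * (S / q)` lie between `0` and `r`, so their difference is at most `q` in
  -- absolute value.
  have e3 : (2 ^ M)⁻¹ * (a * S + ρ) - (q : ℝ)⁻¹ * S = (2 ^ M)⁻¹ * (ρ - r * (S / q)) := by
    have : (a : ℝ) = (2 ^ M - r) / q := by
      rw [← hT]
      field_simp
      ring
    rw [this]
    field_simp
    ring
  have hSq0 : 0 ≤ S / q := by positivity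
  have hSq1 : S / q ≤ 1 := (div_le_one hq0).2 hS1
  rw [adv, e1, e2, e3, abs_mul, abs_of_pos (inv_pos.2 hT0)]
  refine le_trans ?_ hδ
  rw [div_eq_inv_mul (q : ℝ)]
  refine mul_le_mul_of_nonneg_left ?_ (inv_nonneg.2 hT0.le)
  rw [abs_le]
  constructor <;> nlinarith

/-- A matrix sampled with fair coins. -/
def bitsMat (a b q M : ℕ) (x : Fin a × Fin b × Fin M → Bool) : Matrix (Fin a) (Fin b) (ZMod q) :=
  Matrix.of fun i j => bitsMod q fun k => x (i, j, k)

theorem statClose_bitsMat {a b q M : ℕ} [NeZero q] {δ : ℝ} (hδ : (q : ℝ) / 2 ^ M ≤ δ) :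
    StatClose ((a * b : ℕ) * δ)
      ((PMF.uniformOfFintype (Fin a × Fin b × Fin M → Bool)).map (bitsMat a b q M))
      (uniformMatrix a b q) := by
  intro β f s
  have hδ0 : 0 ≤ δ := le_trans (by positivity) hδ
  let e : (Fin (a * b) → ZMod q) ≃ Matrix (Fin a) (Fin b) (ZMod q) :=
    (Equiv.arrowCongr finProdFinEquiv.symm (Equiv.refl _)).trans
      ((Equiv.curry _ _ _).trans Matrix.of)
  let e' : (Fin (a * b) → Fin M → Bool) ≃ (Fin a × Fin b × Fin M → Bool) :=
    (Equiv.curry _ _ _).symm.trans (Equiv.arrowCongr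
      ((Equiv.prodCongr finProdFinEquiv.symm (Equiv.refl _)).trans (Equiv.prodAssoc _ _ _))
      (Equiv.refl _))
  have h1 : ((PMF.uniformOfFintype (Fin a × Fin b × Fin M → Bool)).map (bitsMat a b q M)).bind f =
      (PMF.uniformOfFintype (Fin (a * b) → Fin M → Bool)).bind fun ξ =>
        f (e fun i => bitsMod q (ξ i)) := by
    rw [PMF.bind_map, ← uniform_bind_equiv e']
    rfl
  have h2 : (uniformMatrix a b q).bind f =
      (PMF.uniformOfFintype (Fin (a * b) → ZMod q)).bind fun ξ => f (e ξ) :=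
    (uniform_bind_equiv e f).symm
  rw [h1, h2]
  rcases Nat.eq_zero_or_pos (a * b) with hd | hd
  · have : IsEmpty (Fin (a * b)) := by rw [hd]; infer_instance
    have e0 : ∀ ξ, f (e ξ) = f (e isEmptyElim) := fun ξ => by
      rw [Subsingleton.elim ξ isEmptyElim]
    simp only [e0 _, PMF.bind_const, adv_self]
    positivity
  -- The hybrid argument is applied to single entries as columns, with no common randomness.
  · obtain ⟨j, ξ₁, ξ₂, h⟩ := hybrid hd (PMF.pure ()) (PMF.uniformOfFintype (Fin M → Bool))
      (PMF.uniformOfFintype (ZMod q)) (fun _ => bitsMod q) (fun _ z => z) (fun _ c => f (e c)) s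
    simp only [iid_uniform, PMF.pure_bind] at h
    refine h.trans (mul_le_mul_of_nonneg_left ?_ (Nat.cast_nonneg _))
    have := statClose_bitsMod hδ (fun z => f (e (Function.update
      (fun i => if i < j then ξ₂ i else bitsMod q (ξ₁ i)) j z))) s
    rwa [PMF.bind_map] at this

theorem uniform_sum_bind {ι κ β : Type} [Fintype ι] [DecidableEq ι] [Fintype κ] [DecidableEq κ]
    (f : (ι ⊕ κ → Bool) → PMF β) :
    (PMF.uniformOfFintype (ι ⊕ κ → Bool)).bind f =
      (PMF.uniformOfFintype (ι → Bool)).bind fun x => (PMF.uniformOfFintype (κ → Bool)).bind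
        fun y => f (Sum.elim x y) := by
  rw [uniform_bind_prod fun x y => f (Sum.elim x y)]
  exact (uniform_bind_equiv (Equiv.sumArrowEquivProdArrow ι κ Bool).symm f).symm

/-! ### The simulator -/

/-- The coins for an `a × b` matrix modulo `q` with statistical security parameter `κ`. -/
abbrev MatCoins (a b q κ : ℕ) : Type := Fin a × Fin b × Fin (Nat.clog 2 q + κ)

/-- The coins of the simulator. -/
abbrev SimCoins (p : Params) (κ : ℕ) : Type :=
  MatCoins p.n p.d₂ p.q κ ⊕ MatCoins p.n p.t p.q κ ⊕ MatCoins p.d₂ p.d₁ p.q κ ⊕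
    MatCoins p.t p.d₁ p.q κ ⊕ MatCoins p.n p.d₁ p.q κ ⊕ MatCoins p.d₂ p.d₃ p.q κ ⊕
    MatCoins p.t p.d₃ 3 κ ⊕ MatCoins p.n p.d₃ p.q κ

instance (p : Params) (κ : ℕ) : DecidableEq (SimCoins p κ) := by
  unfold SimCoins MatCoins
  infer_instance

/-- The simulator: all entries of the view are sampled uniformly, up to a small error. -/
def simulate (p : Params) (κ : ℕ) (x : SimCoins p κ → Bool) : ViewBits p → Bool :=
  View.encode {
    A := bitsMat _ _ _ _ fun z => x (.inl z)
    B := bitsMat _ _ _ _ fun z => x (.inr (.inl z))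
    C := bitsMat _ _ _ _ fun z => x (.inr (.inr (.inl z)))
    C' := bitsMat _ _ _ _ fun z => x (.inr (.inr (.inr (.inl z))))
    S := bitsMat _ _ _ _ fun z => x (.inr (.inr (.inr (.inr (.inl z)))))
    Y := bitsMat _ _ _ _ fun z => x (.inr (.inr (.inr (.inr (.inr (.inl z))))))
    R := bitsMat _ _ _ _ fun z => x (.inr (.inr (.inr (.inr (.inr (.inr (.inl z)))))))
    H := bitsMat _ _ _ _ fun z => x (.inr (.inr (.inr (.inr (.inr (.inr (.inr z)))))))
    : View p }

/-- The number of entries of the matrices in a view. -/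
def viewEntries (p : Params) : ℕ :=
  p.n * p.d₂ + (p.n * p.t + (p.d₂ * p.d₁ + (p.t * p.d₁ + (p.n * p.d₁ + (p.d₂ * p.d₃ +
    (p.t * p.d₃ + p.n * p.d₃))))))

theorem div_two_pow_le (q κ : ℕ) : (q : ℝ) / 2 ^ (Nat.clog 2 q + κ) ≤ (2 ^ κ)⁻¹ := by
  have h : (q : ℝ) ≤ 2 ^ Nat.clog 2 q := by exact_mod_cast Nat.le_pow_clog (by norm_num) q
  rw [pow_add, div_le_iff₀ (by positivity)]
  calc (q : ℝ) ≤ 2 ^ Nat.clog 2 q := h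
    _ = _ := by field_simp

theorem adv_simulate_uniformView (p : Params) (κ : ℕ) (s : Set (ViewBits p → Bool)) :
    adv s ((PMF.uniformOfFintype (SimCoins p κ → Bool)).map (simulate p κ)) (uniformView p) ≤
      viewEntries p * (2 ^ κ)⁻¹ := by
  have hc : ∀ (a b q : ℕ) [NeZero q], StatClose ((a * b : ℕ) * ((2 : ℝ) ^ κ)⁻¹)
      ((PMF.uniformOfFintype (MatCoins a b q κ → Bool)).map (bitsMat a b q _))
      (uniformMatrix a b q) := fun a b q _ => statClose_bitsMat (div_two_pow_le q κ)
  have e : (PMF.uniformOfFintype (SimCoins p κ → Bool)).map (simulate p κ) =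
      ((PMF.uniformOfFintype (MatCoins p.n p.d₂ p.q κ → Bool)).map (bitsMat _ _ _ _)).bind fun A =>
      ((PMF.uniformOfFintype (MatCoins p.n p.t p.q κ → Bool)).map (bitsMat _ _ _ _)).bind fun B =>
      ((PMF.uniformOfFintype (MatCoins p.d₂ p.d₁ p.q κ → Bool)).map (bitsMat _ _ _ _)).bind fun C =>
      ((PMF.uniformOfFintype (MatCoins p.t p.d₁ p.q κ → Bool)).map (bitsMat _ _ _ _)).bind fun C' =>
      ((PMF.uniformOfFintype (MatCoins p.n p.d₁ p.q κ → Bool)).map (bitsMat _ _ _ _)).bind fun S =>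
      ((PMF.uniformOfFintype (MatCoins p.d₂ p.d₃ p.q κ → Bool)).map (bitsMat _ _ _ _)).bind fun Y =>
      ((PMF.uniformOfFintype (MatCoins p.t p.d₃ 3 κ → Bool)).map (bitsMat _ _ _ _)).bind fun R =>
      ((PMF.uniformOfFintype (MatCoins p.n p.d₃ p.q κ → Bool)).map (bitsMat _ _ _ _)).bind fun H =>
      PMF.pure (View.encode
        { A := A, B := B, C := C, C' := C', S := S, Y := Y, R := R, H := H : View p }) := by
    rw [← PMF.bind_pure_comp]
    simp only [uniform_sum_bind, PMF.bind_map, Function.comp_def]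
    rfl
  rw [e]
  refine (StatClose.adv_bind_le (hc _ _ _) fun A => StatClose.adv_bind_le (hc _ _ _) fun B =>
    StatClose.adv_bind_le (hc _ _ _) fun C => StatClose.adv_bind_le (hc _ _ _) fun C' =>
    StatClose.adv_bind_le (hc _ _ _) fun S => StatClose.adv_bind_le (hc _ _ _) fun Y =>
    StatClose.adv_bind_le (hc _ _ _) fun R => hc _ _ _ _ s).trans (le_of_eq ?_)
  rw [viewEntries]
  push_cast
  ring

/-- A sampled residue is a linear form in its coins with coefficients the powers of two, so the
circuits for affine forms apply. -/
theorem Adds.bitsMod {ι : Type} {q M r : ℕ} [NeZero q] (c : Fin M → ι) (hM : M * modCost q ≤ r)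
    (j : Fin (Nat.clog 2 q)) :
    Adds r (∅ : Set ((ι → Bool) → Bool))
      {fun x => (SecureMult.bitsMod q fun k => x (c k)).val.testBit j} := by
  have h := Adds.affine (0 : ZMod q)
    ((Finset.univ : Finset (Fin M)).toList.map fun k => (c k, (2 : ZMod q) ^ (k : ℕ))) j
  have e : ∀ x : ι → Bool, affineForm (0 : ZMod q)
      ((Finset.univ : Finset (Fin M)).toList.map fun k => (c k, (2 : ZMod q) ^ (k : ℕ))) x =
      SecureMult.bitsMod q fun k => x (c k) := by
    intro x
    rw [affineForm, zero_add, List.map_map, SecureMult.bitsMod, ← Finset.sum_map_toList]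
    rfl
  simp only [e] at h
  exact h.mono (by simpa using hM) subset_rfl

/-- The number of gates that suffice for one bit of the simulator. -/
def simCost (p : Params) (κ : ℕ) : ℕ :=
  (Nat.clog 2 p.q + κ) * modCost p.q + (Nat.clog 2 3 + κ) * modCost 3

/-- The bound holds for every event, not only for those decided by small circuits: the simulator is
statistically close to the uniform view. -/
theorem exists_simulator (p : Params) (κ : ℕ) :
    ∃ (c : ℕ) (G : Circuit (Fin c) (ViewBits p)),
      G.size ≤ Fintype.card (ViewBits p) * simCost p κ + Fintype.card (ViewBits p) ∧
      ∀ s, adv s (samplerDist G) (uniformView p) ≤ viewEntries p * (2 ^ κ)⁻¹ := by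
  set e := Fintype.equivFin (SimCoins p κ)
  have hq : (Nat.clog 2 p.q + κ) * modCost p.q ≤ simCost p κ := Nat.le_add_right _ _
  have h3 : (Nat.clog 2 3 + κ) * modCost 3 ≤ simCost p κ := Nat.le_add_left _ _
  have hA : Adds (Fintype.card (ViewBits p) * simCost p κ) ∅
      (Set.range fun z (x : Fin (Fintype.card (SimCoins p κ)) → Bool) =>
        simulate p κ (fun y => x (e y)) z) := by
    refine Adds.range fun z => ?_
    rcases z with z | z | z | z | z | z | z | z
    · exact Adds.bitsMod (fun k => e (.inl (z.1, z.2.1, k))) hq z.2.2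
    · exact Adds.bitsMod (fun k => e (.inr (.inl (z.1, z.2.1, k)))) hq z.2.2
    · exact Adds.bitsMod (fun k => e (.inr (.inr (.inl (z.1, z.2.1, k))))) hq z.2.2
    · exact Adds.bitsMod (fun k => e (.inr (.inr (.inr (.inl (z.1, z.2.1, k)))))) hq z.2.2
    · exact Adds.bitsMod (fun k => e (.inr (.inr (.inr (.inr (.inl (z.1, z.2.1, k))))))) hq z.2.2
    · exact Adds.bitsMod
        (fun k => e (.inr (.inr (.inr (.inr (.inr (.inl (z.1, z.2.1, k)))))))) hq z.2.2
    · exact Adds.bitsMod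
        (fun k => e (.inr (.inr (.inr (.inr (.inr (.inr (.inl (z.1, z.2.1, k))))))))) h3 z.2.2
    · exact Adds.bitsMod
        (fun k => e (.inr (.inr (.inr (.inr (.inr (.inr (.inr (z.1, z.2.1, k))))))))) hq z.2.2
  obtain ⟨G, hG, hev⟩ := exists_circuit hA
  refine ⟨_, G, Nat.add_le_add_right hG _, fun s => ?_⟩
  have : samplerDist G = (PMF.uniformOfFintype (SimCoins p κ → Bool)).map (simulate p κ) := by
    rw [samplerDist, ← PMF.bind_pure_comp, ← PMF.bind_pure_comp,
      ← uniform_bind_equiv (Equiv.arrowCongr e.symm (Equiv.refl Bool))]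
    refine bind_congr fun x => ?_
    rw [Function.comp_apply, hev]
    rfl
  rw [this]
  exact adv_simulate_uniformView p κ s

/-! ### The hash is statistically hiding under the SIS assumption -/

/-- The circuit that outputs the first standard basis vector. -/
def basisCircuit (ι : Type) (t : ℕ) : Circuit ι (Fin t × Fin (1 + 1)) where
  gates := []
  output z := .const (decide (z.1.val = 0 ∧ z.2 = 1))

theorem decodeInt_basisCircuit {ι : Type} {t : ℕ} (x : ι → Bool) (i : Fin t) :
    decodeInt (fun b => (basisCircuit ι t).eval x (i, b)) = if i.val = 0 then 1 else 0 := by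
  have h1 : (0 : Fin 1).succ = (1 : Fin (1 + 1)) := rfl
  rw [decodeInt, Fin.sum_univ_one]
  by_cases hi : i.val = 0 <;> simp [basisCircuit, Circuit.eval, Wire.value, hi, h1]

/-- For each `A` the constant answer solves the instance with `h` equal to the first column of `A`,
and a uniform `h` takes that value with probability `q ^ (-n)`. The hardness of SIS therefore makes
`q ^ (-n)` negligible. -/
theorem inv_le_sisSuccess {n t q : ℕ} [NeZero q] (ht : 0 < t) {β : ℝ} (hβ : 1 ≤ β) :
    ((q : ℝ) ^ n)⁻¹ ≤ sisSuccess β (basisCircuit (SISBits n t q) t) := by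
  set r : Fin t → ℤ := fun i => if i.val = 0 then 1 else 0 with hr
  set s : Set (Matrix (Fin n) (Fin t) (ZMod q) × (Fin n → ZMod q)) := {z | IsSISSolution β z.1 z.2
    fun i => decodeInt fun b => (basisCircuit (SISBits n t q) t).eval
      (Sum.elim (encMat z.1) (encVec z.2)) (i, b)} with hs
  have hmem : ∀ A : Matrix (Fin n) (Fin t) (ZMod q), (A, A *ᵥ fun i => (r i : ZMod q)) ∈ s := by
    intro A
    simp only [hs, Set.mem_ofPred_eq, decodeInt_basisCircuit]
    refine ⟨fun h => ?_, fun i => ?_, rfl⟩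
    · simpa using congrFun h ⟨0, ht⟩
    · beta_reduce
      split_ifs
      · simpa using hβ
      · simpa using zero_le_one.trans hβ
  have hpure : ∀ z, z ∈ s → prob s (PMF.pure z) = 1 := by
    intro z hz
    rw [prob, PMF.toOuterMeasure_pure_apply, if_pos hz, ENNReal.toReal_one]
  change _ ≤ prob s (sisInstance n t q)
  simp only [sisInstance, bind, pure]
  rw [prob_bind]
  calc ((q : ℝ) ^ n)⁻¹ = ∑ A, (uniformMatrix n t q A).toReal * ((q : ℝ) ^ n)⁻¹ := by
        rw [← Finset.sum_mul, sum_toReal, one_mul]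
    _ ≤ _ := by
        refine Finset.sum_le_sum fun A _ => mul_le_mul_of_nonneg_left ?_ ENNReal.toReal_nonneg
        rw [prob_bind]
        refine le_trans (le_of_eq ?_) (Finset.single_le_sum
          (f := fun h => (uniformVec n q h).toReal * prob s (PMF.pure (A, h)))
          (fun h _ => mul_nonneg ENNReal.toReal_nonneg (prob_nonneg _ _))
          (Finset.mem_univ (A *ᵥ fun i => (r i : ZMod q))))
        simp only [hpure _ (hmem A), mul_one]
        simp [uniformVec]

theorem pow_le_two_pow {n t q : ℕ} (hq : 2 ≤ q) (ht : 2 * (n : ℝ) * Real.logb 2 q ≤ t) :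
    (q : ℝ) ^ (2 * n) ≤ 2 ^ t := by
  have hq0 : (0 : ℝ) < q := by positivity
  calc (q : ℝ) ^ (2 * n) = ((2 : ℝ) ^ Real.logb 2 q) ^ (2 * n) := by
        rw [Real.rpow_logb (by norm_num) (by norm_num) hq0]
    _ = (2 : ℝ) ^ (2 * (n : ℝ) * Real.logb 2 q) := by
        rw [← Real.rpow_natCast, ← Real.rpow_mul (by norm_num)]
        push_cast
        ring_nf
    _ ≤ (2 : ℝ) ^ (t : ℝ) := Real.rpow_le_rpow_of_exponent_le (by norm_num) ht
    _ = 2 ^ t := Real.rpow_natCast _ _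

theorem pos_of_pow_le {n t q : ℕ} (hq : 2 ≤ q) (h : (q : ℝ) ^ (2 * n) ≤ 2 ^ t) (hn : n ≠ 0) :
    0 < t := by
  rcases Nat.eq_zero_or_pos t with rfl | ht
  · have h1 : (1 : ℝ) < (q : ℝ) ^ (2 * n) :=
      one_lt_pow₀ (by exact_mod_cast (by omega : 1 < q)) (by omega)
    simp only [pow_zero] at h
    linarith
  · exact ht

/-! ### Computational indistinguishability -/

theorem CompIndist.trans {ι : ℕ → Type} {P Q R : ∀ κ, PMF (ι κ → Bool)} (h : CompIndist P Q)
    (h' : CompIndist Q R) : CompIndist P R := fun D hD =>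
  ((h D hD).add (h' D hD)).mono fun κ => by
    rw [abs_abs]
    exact abs_sub_le _ _ _

theorem polyBounded_modCost {q : ℕ → ℕ} (h : PolyBounded fun κ => Nat.clog 2 (q κ)) :
    PolyBounded fun κ => modCost (q κ) :=
  h.mul (((PolyBounded.const 18).mul h).add (.const 22))

theorem polyBounded_card_viewBits {p : ℕ → Params} (hp : PolyParams p) :
    PolyBounded fun κ => Fintype.card (ViewBits (p κ)) := by
  simp only [Fintype.card_sum, Fintype.card_prod, Fintype.card_fin]
  have hK := hp.log_q
  exact (hp.n.mul (hp.d₂.mul hK)).add <| (hp.n.mul (hp.t.mul hK)).add <|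
    (hp.d₂.mul (hp.d₁.mul hK)).add <| (hp.t.mul (hp.d₁.mul hK)).add <|
    (hp.n.mul (hp.d₁.mul hK)).add <| (hp.d₂.mul (hp.d₃.mul hK)).add <|
    (hp.t.mul (hp.d₃.mul (.const _))).add (hp.n.mul (hp.d₃.mul hK))

theorem polyBounded_viewEntries {p : ℕ → Params} (hp : PolyParams p) :
    PolyBounded fun κ => viewEntries (p κ) :=
  (hp.n.mul hp.d₂).add <| (hp.n.mul hp.t).add <| (hp.d₂.mul hp.d₁).add <| (hp.t.mul hp.d₁).add <|
    (hp.n.mul hp.d₁).add <| (hp.d₂.mul hp.d₃).add <| (hp.t.mul hp.d₃).add (hp.n.mul hp.d₃)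

theorem compIndist_uniformView {p : ℕ → Params} (hp : PolyParams p)
    (ht : ∀ κ, 2 * ((p κ).n : ℝ) * Real.logb 2 (p κ).q ≤ (p κ).t)
    {β : ℕ → ℝ} (hβ : ∀ κ, 1 ≤ β κ)
    (hLWE : LWEAssumption p fun κ => (p κ).d₂ + (p κ).t)
    (hSIS : SISAssumption p β) (i : Fin 2)
    (X : ∀ κ, Matrix (Fin (p κ).d₁) (Fin (p κ).d₂) (fixedPoint (p κ).k (p κ).l))
    (Y : ∀ κ, Matrix (Fin (p κ).d₂) (Fin (p κ).d₃) (fixedPoint (p κ).k (p κ).l)) :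
    CompIndist (fun κ => viewDist i (p κ) (X κ) (Y κ)) (fun κ => uniformView (p κ)) := by
  intro D hD
  set sis : ℕ → ℝ := fun κ => sisSuccess (β κ)
    (basisCircuit (SISBits (p κ).n (p κ).t (p κ).q) (p κ).t) with hsis
  have hsis0 : ∀ κ, 0 ≤ sis κ := fun κ => ENNReal.toReal_nonneg
  have hnegl : Negligible sis := by
    refine hSIS (fun _ => 1) _ (PolyBounded.mono (hp.t.mul (.const 2)) fun κ => ?_)
    simp [Circuit.size, basisCircuit]
  -- The hashing error is expressed through the SIS success probability rather than `q ^ (-n)`: the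
  -- former is negligible as a function of `κ`, whereas the latter equals `1` wherever `n = 0`.
  set ε : ℕ → ℝ := fun κ => √(√(sis κ)) with hε
  have hε4 : ∀ κ, ε κ ^ 4 = sis κ := by
    intro κ
    calc ε κ ^ 4 = (√(√(sis κ)) ^ 2) ^ 2 := by rw [hε]; ring
      _ = sis κ := by rw [Real.sq_sqrt (Real.sqrt_nonneg _), Real.sq_sqrt (hsis0 κ)]
  have hεn : Negligible ε := hnegl.of_pow_four_le fun κ => (hε4 κ).le
  choose D' hsize hadv using fun κ =>
    exists_lwe_distinguisher (p κ) (encodeFixed (p κ).l (p κ).q (X κ)) (D κ)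
  have hD' : PolyBounded fun κ => (D' κ).size :=
    PolyBounded.mono (((polyBounded_card_viewBits hp).mul
      (((hp.n.add (.const 1)).mul hp.log_q).mul (polyBounded_modCost hp.log_q))).add hD) hsize
  refine Negligible.mono ((hεn.polyBounded_mul hp.d₃).add
    ((hLWE D' hD').polyBounded_mul hp.d₁)) fun κ => ?_
  rw [abs_abs]
  have hpow := pow_le_two_pow (p κ).two_le_q (ht κ)
  have h1 := adv_viewDist_idealView i (p κ) (X κ) (Y κ) hpow (Real.sqrt_nonneg _ : 0 ≤ ε κ)
    (fun hn => by
      rw [hε4]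
      exact inv_le_sisSuccess (pos_of_pow_le (p κ).two_le_q hpow hn) (hβ κ))
    {x | (D κ).eval x () = true}
  exact (abs_sub_le _ _ _).trans (add_le_add h1 (hadv κ))

end SecureMult

end

open SecureMult in
theorem mainTheorem3 (p : ℕ → Params) (hp : PolyParams p)
    (ht : ∀ κ, 2 * ((p κ).n : ℝ) * Real.logb 2 (p κ).q ≤ (p κ).t)
    (β : ℕ → ℝ) (hβ : ∀ κ, 2 ≤ β κ)
    (hLWE : LWEAssumption p fun κ => (p κ).d₂ + (p κ).t)
    (hSIS : SISAssumption p β) (i : Fin 2) :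
    ∃ (c : ℕ → ℕ) (Sim : ∀ κ, Circuit (Fin (c κ)) (ViewBits (p κ))),
      PolyBounded (fun κ => (Sim κ).size) ∧
      ∀ (X : ∀ κ, Matrix (Fin (p κ).d₁) (Fin (p κ).d₂) (fixedPoint (p κ).k (p κ).l))
        (Y : ∀ κ, Matrix (Fin (p κ).d₂) (Fin (p κ).d₃) (fixedPoint (p κ).k (p κ).l)),
        CompIndist (fun κ => viewDist i (p κ) (X κ) (Y κ)) (fun κ => samplerDist (Sim κ)) ∧
        CompIndist (fun κ => viewDist i (p κ) (X κ) (Y κ)) (fun κ => uniformView (p κ)) := by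
  -- The simulator is chosen before `X` and `Y` and does not depend on `i`: one circuit family
  -- serves both parties.
  choose c Sim hsize hadv using fun κ => exists_simulator (p κ) κ
  have hcard := polyBounded_card_viewBits hp
  refine ⟨c, Sim, ?_, fun X Y => ?_⟩
  · refine PolyBounded.mono ((hcard.mul ?_).add hcard) hsize
    exact ((hp.log_q.add .id).mul (polyBounded_modCost hp.log_q)).add
      (((PolyBounded.const _).add .id).mul (.const _))
  · have hu := compIndist_uniformView hp ht (fun κ => one_le_two.trans (hβ κ)) hLWE hSIS i X Y
    refine ⟨hu.trans fun D _ => ?_, hu⟩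
    -- The error is at most `2 ^ (-κ)` for each of polynomially many entries.
    refine Negligible.mono (negligible_two_pow.polyBounded_mul (polyBounded_viewEntries hp))
      fun κ => ?_
    rw [abs_abs, abs_sub_comm]
    exact hadv κ {x | (D κ).eval x () = true}
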